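/- Conventions. For $2$-categories $\mathfrak{X},\mathfrak{Y}$ let $[\mathfrak{X},\mathfrak{Y}]_{PS}$ be the $2$-category of pseudofunctors $\mathfrak{X}\to\mathfrak{Y}$, pseudonatural transformations and modifications. * For an object $x$ of a $2$-category $\dot{\mathfrak{x}}$, an *$x$-inclusion* is a $2$-functor $\mathrm{s}:\mathfrak{x}\to\dot{\mathfrak{x}}$ that is injective on objects, is an isomorphism on hom-categories, and satisfies $\mathrm{obj}(\dot{\mathfrak{x}})=\mathrm{s}(\mathrm{obj}(\mathfrak{x}))\sqcup\{x\}$. * Given $\mathrm{s}:\mathfrak{x}\to\dot{\mathfrak{x}}$ and a $2$-category $\mathfrak{K}$, $\mathcal{P}s\mathcal{R}an_{\mathrm{s}}:[\mathfrak{x},\mathfrak{K}]_{PS}\to[\dot{\mathfrak{x}},\mathfrak{K}]_{PS}$ denotes a right biadjoint (if it exists) of the precomposition pseudofunctor $[\mathrm{s},\mathfrak{K}]_{PS}: \mathcal{A}\mapsto\mathcal{A}\circ\mathrm{s}$, and $\langle\mathrm{s}\rangle=\mathcal{P}s\mathcal{R}an_{\mathrm{s}}(-\circ\mathrm{s})$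 denotes the pseudomonad on $[\dot{\mathfrak{x}},\mathfrak{K}]_{PS}$ induced by this biadjunction. It is *pointwise* if, for every $\mathcal{A}:\mathfrak{x}\to\mathfrak{K}$, the right pseudo-Kan extension $\mathcal{P}s\mathcal{R}an_{\mathrm{s}}\mathcal{A}$ (with the counit component $(\mathcal{P}s\mathcal{R}an_{\mathrm{s}}\mathcal{A})\circ \mathrm{s}\to\mathcal{A}$) is preserved by all representables $\mathfrak{K}(Z,-):\mathfrak{K}\to\mathrm{CAT}$. * A pseudomonad $(\mathcal{T},\mu,\eta,\dots)$ is *idempotent* if there is an invertible modification $\eta\mathcal{T}\cong\mathcal{T}\eta$. A *$\mathcal{T}$-pseudoalgebra structure* on an object $X$ is a left adjoint $a:\mathcal{T}X\to X$ of $\eta_X:X\to\mathcal{T}X$ such that the adjunction $a\dashv\eta_X$ is an adjoint equivalence; thus $X$ can be endowed with one if and only if $\eta_X$ is an equivalence. $\mathsf{Ps}\text{-}\mathcal{T}\text{-}\mathsf{Alg}$ is the full sub-$2$-category of the objects that can be endowed with such a structure. * A pseudofunctor $\mathcal{A}:\dot{\mathfrak{x}}\to\mathfrak{K}$ is of *effective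 $\mathrm{s}$-descent* if it can be endowed with an $\langle\mathrm{s}\rangle$-pseudoalgebra structure, i.e. if the comparison $\mathcal{A}\to\mathcal{P}s\mathcal{R}an_{\mathrm{s}}(\mathcal{A}\circ\mathrm{s})$ (the unit component) is an equivalence in $[\dot{\mathfrak{x}},\mathfrak{K}]_{PS}$. **Theorem.** Let $\mathrm{t}:\mathfrak{a}\to\dot{\mathfrak{a}}$ be an $\mathsf{a}$-inclusion. (i) Let $\mathfrak{K}$ be a $2$-category for which $\mathcal{P}s\mathcal{R}an_{\mathrm{t}}:[\mathfrak{a},\mathfrak{K}]_{PS}\to[\dot{\mathfrak{a}},\mathfrak{K}]_{PS}$ exists, and let $\mathcal{T}$ be an idempotent pseudomonad on $\mathfrak{K}$. If $\mathcal{A}:\dot{\mathfrak{a}}\to\mathfrak{K}$ is a pseudofunctor of effective $\mathrm{t}$-descent such that $\mathcal{A}\circ\mathrm{t}$ factors through the full inclusion $\mathsf{Ps}\text{-}\mathcal{T}\text{-}\mathsf{Alg}\to\mathfrak{K}$ (that is, every object $\mathcal{A}(\mathrm{t}(i))$ can be endowed with a $\mathcal{T}$-pseudoalgebra structure), then $\mathcal{A}(\mathsf{a})$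 can be endowed with a $\mathcal{T}$-pseudoalgebra structure. (ii) (Commutativity of bilimits.) Let $\mathrm{h}:\mathfrak{b}\to\dot{\mathfrak{b}}$ be a $\mathsf{b}$-inclusion and $\mathfrak{H}$ a $2$-category such that $\mathcal{P}s\mathcal{R}an_{\mathrm{h}}:[\mathfrak{b},\mathfrak{H}]_{PS}\to[\dot{\mathfrak{b}},\mathfrak{H}]_{PS}$ exists and is pointwise, and such that $\mathcal{P}s\mathcal{R}an_{\mathrm{t}}:[\mathfrak{a},[\dot{\mathfrak{b}},\mathfrak{H}]_{PS}]_{PS}\to[\dot{\mathfrak{a}},[\dot{\mathfrak{b}},\mathfrak{H}]_{PS}]_{PS}$ exists. If $\mathcal{A}:\dot{\mathfrak{a}}\to[\dot{\mathfrak{b}},\mathfrak{H}]_{PS}$ is a pseudofunctor of effective $\mathrm{t}$-descent such that every diagram $\mathcal{A}(\mathrm{t}(i)):\dot{\mathfrak{b}}\to\mathfrak{H}$, $i\in\mathfrak{a}$, is of effective $\mathrm{h}$-descent, then $\mathcal{A}(\mathsf{a}):\dot{\mathfrak{b}}\to\mathfrak{H}$ is of effective $\mathrm{h}$-descent. -/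

import Mathlib

open CategoryTheory Bicategory
open scoped Pseudofunctor.StrongTrans

universe w₁ w₂ w₃ w₄ w₅ v₁ v₂ v₃ v₄ v₅ u₁ u₂ u₃ u₄ u₅ u₆

namespace PsDescent

section

variable {B : Type u₁} [Bicategory.{w₁, v₁} B] {C : Type u₂} [Bicategory.{w₂, v₂} C]
  {D : Type u₃} [Bicategory.{w₃, v₃} D]

/-- Precomposition of a pseudonatural transformation `α : F ⟶ G` with a pseudofunctor `t`.
Here `t.comp F` is `t` followed by `F`. -/
def preWhisker (t : B ⥤ᵖ C) {F G : C ⥤ᵖ D} (α : F ⟶ G) : t.comp F ⟶ t.comp G where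
  app b := α.app (t.obj b)
  naturality f := α.naturality (t.map f)
  naturality_naturality η := α.naturality_naturality (t.map₂ η)
  naturality_id a := by
    have h : (α.naturality (t.map (𝟙 a))).hom ≫ α.app (t.obj a) ◁
        (G.map₂ (t.mapId a).hom ≫ (G.mapId (t.obj a)).hom) =
      (F.map₂ (t.mapId a).hom ≫ (F.mapId (t.obj a)).hom) ▷ α.app (t.obj a) ≫
        (λ_ _).hom ≫ (ρ_ _).inv := by
      rw [whiskerLeft_comp, comp_whiskerRight, Category.assoc,
        ← α.naturality_naturality_assoc, α.naturality_id]
    exact h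
  naturality_comp {a b c} f g := by
    have h : (α.naturality (t.map (f ≫ g))).hom ≫ α.app (t.obj a) ◁
        (G.map₂ (t.mapComp f g).hom ≫ (G.mapComp (t.map f) (t.map g)).hom) =
      (F.map₂ (t.mapComp f g).hom ≫ (F.mapComp (t.map f) (t.map g)).hom) ▷ α.app (t.obj c) ≫
        (α_ _ _ _).hom ≫ F.map (t.map f) ◁ (α.naturality (t.map g)).hom ≫
        (α_ _ _ _).inv ≫ (α.naturality (t.map f)).hom ▷ G.map (t.map g) ≫ (α_ _ _ _).hom := by
      rw [whiskerLeft_comp, comp_whiskerRight, Category.assoc,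
        ← α.naturality_naturality_assoc, α.naturality_comp]
    exact h

/-- The pseudofunctor `[t, D]_PS : [C, D]_PS ⥤ [B, D]_PS`, precomposition with `t`. Objects are
pseudofunctors, 1-cells pseudonatural transformations, 2-cells modifications. -/
def precomp (t : B ⥤ᵖ C) (D : Type u₃) [Bicategory.{w₃, v₃} D] : (C ⥤ᵖ D) ⥤ᵖ (B ⥤ᵖ D) where
  obj F := t.comp F
  map α := preWhisker t α
  map₂ Γ := ⟨{ app b := Γ.as.app (t.obj b), naturality f := Γ.as.naturality (t.map f) }⟩
  map₂_id _ := rfl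
  map₂_comp _ _ := rfl
  mapId F := Pseudofunctor.StrongTrans.isoMk (fun b => Iso.refl (𝟙 (F.obj (t.obj b)))) (by
    intro a b f
    have h : F.map (t.map f) ◁ 𝟙 (𝟙 (F.obj (t.obj b))) ≫
        ((ρ_ (F.map (t.map f))).hom ≫ (λ_ (F.map (t.map f))).inv) =
      ((ρ_ (F.map (t.map f))).hom ≫ (λ_ (F.map (t.map f))).inv) ≫
        𝟙 (𝟙 (F.obj (t.obj a))) ▷ F.map (t.map f) := by simp
    exact h)
  mapComp {F G K} α β :=
    Pseudofunctor.StrongTrans.isoMk (fun b => Iso.refl (α.app (t.obj b) ≫ β.app (t.obj b))) (by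
      intro a b f
      have h : F.map (t.map f) ◁ 𝟙 (α.app (t.obj b) ≫ β.app (t.obj b)) ≫
          ((α ≫ β).naturality (t.map f)).hom =
        ((α ≫ β).naturality (t.map f)).hom ≫
          𝟙 (α.app (t.obj a) ≫ β.app (t.obj a)) ▷ K.map (t.map f) := by
        rw [whiskerLeft_id, id_whiskerRight]
        exact (Category.id_comp _).trans (Category.comp_id _).symm
      exact h)
  map₂_whisker_left {F G K} α β γ Γ := by
    ext b
    have h : α.app (t.obj b) ◁ Γ.as.app (t.obj b) =
      𝟙 _ ≫ (α.app (t.obj b) ◁ Γ.as.app (t.obj b)) ≫ 𝟙 _ := by simp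
    exact h
  map₂_whisker_right {F G K α β} Γ γ := by
    ext b
    have h : Γ.as.app (t.obj b) ▷ γ.app (t.obj b) =
      𝟙 _ ≫ (Γ.as.app (t.obj b) ▷ γ.app (t.obj b)) ≫ 𝟙 _ := by simp
    exact h
  map₂_associator {F G K L} α β γ := by
    ext b
    have h : (α_ (α.app (t.obj b)) (β.app (t.obj b)) (γ.app (t.obj b))).hom =
      𝟙 _ ≫ (𝟙 _ ▷ _) ≫ (α_ (α.app (t.obj b)) (β.app (t.obj b)) (γ.app (t.obj b))).hom ≫
        (_ ◁ 𝟙 _) ≫ 𝟙 _ := by simp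
    exact h
  map₂_left_unitor {F G} α := by
    ext b
    have h : (λ_ (α.app (t.obj b))).hom =
      𝟙 _ ≫ (𝟙 _ ▷ _) ≫ (λ_ (α.app (t.obj b))).hom := by simp
    exact h
  map₂_right_unitor {F G} α := by
    ext b
    have h : (ρ_ (α.app (t.obj b))).hom =
      𝟙 _ ≫ (_ ◁ 𝟙 _) ≫ (ρ_ (α.app (t.obj b))).hom := by simp
    exact h

/-- The representable pseudofunctor `D(Z, -)`. -/
def representable (Z : D) : D ⥤ᵖ Cat.{w₃, v₃} where
  toPrelaxFunctor := PrelaxFunctor.mkOfHomFunctors (fun y => Cat.of (Z ⟶ y))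
    (fun a b => postcomposingCat Z a b)
  mapId a := rightUnitorNatIsoCat Z a
  mapComp f g := (associatorNatIsoLeftCat Z f g).symm
  map₂_whisker_left {a b c} f g h η := by
    ext x
    have e : ∀ x : Z ⟶ a, x ◁ (f ◁ η) = (α_ x f g).inv ≫ ((x ≫ f) ◁ η ≫ (α_ x f h).hom) := by
      simp
    exact e x
  map₂_whisker_right {a b c} f g η h := by
    ext x
    have e : ∀ x : Z ⟶ a, x ◁ (η ▷ h) = (α_ x f h).inv ≫ ((x ◁ η) ▷ h ≫ (α_ x g h).hom) := by
      simp
    exact e x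
  map₂_associator {a b c d} f g h := by
    ext x
    have e : ∀ x : Z ⟶ a, x ◁ (α_ f g h).hom = (α_ x (f ≫ g) h).inv ≫ ((α_ x f g).inv ▷ h ≫
      (𝟙 _ ≫ ((α_ (x ≫ f) g h).hom ≫ (α_ x f (g ≫ h)).hom))) := by
      intro x
      simp
    exact e x
  map₂_left_unitor {a b} f := by
    ext x
    have e : ∀ x : Z ⟶ a,
        x ◁ (λ_ f).hom = (α_ x (𝟙 a) f).inv ≫ ((ρ_ x).hom ▷ f ≫ 𝟙 _) := by simp
    exact e x
  map₂_right_unitor {a b} f := by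
    ext x
    have e : ∀ x : Z ⟶ a,
        x ◁ (ρ_ f).hom = (α_ x f (𝟙 b)).inv ≫ ((ρ_ (x ≫ f)).hom ≫ 𝟙 _) := by simp
    exact e x

/-- The image under a pseudofunctor of a square that commutes up to an invertible 2-cell. -/
def mapSq (F : B ⥤ᵖ C) {a a' b b' : B} {f : a ⟶ b} {v : b ⟶ b'} {u : a ⟶ a'} {g : a' ⟶ b'}
    (p : f ≫ v ≅ u ≫ g) : F.map f ≫ F.map v ≅ F.map u ≫ F.map g :=
  (F.mapComp f v).symm ≪≫ F.map₂Iso p ≪≫ F.mapComp u g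

/-- Pasting of two adjacent squares that commute up to invertible 2-cells. -/
def hpaste {a₁ a₂ a₃ b₁ b₂ b₃ : B} {f₁ : a₁ ⟶ b₁} {f₂ : a₂ ⟶ b₂} {f₃ : a₃ ⟶ b₃}
    {u : a₁ ⟶ a₂} {v : b₁ ⟶ b₂} {u' : a₂ ⟶ a₃} {v' : b₂ ⟶ b₃}
    (p : f₁ ≫ v ≅ u ≫ f₂) (q : f₂ ≫ v' ≅ u' ≫ f₃) : f₁ ≫ (v ≫ v') ≅ (u ≫ u') ≫ f₃ :=
  (α_ f₁ v v').symm ≪≫ whiskerRightIso p v' ≪≫ α_ u f₂ v' ≪≫ whiskerLeftIso u q ≪≫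
    (α_ u u' f₃).symm

theorem mapSq_hom (F : B ⥤ᵖ C) {a a' b b' : B} {f : a ⟶ b} {v : b ⟶ b'} {u : a ⟶ a'}
    {g : a' ⟶ b'} (p : f ≫ v ≅ u ≫ g) :
    (mapSq F p).hom = (F.mapComp f v).inv ≫ F.map₂ p.hom ≫ (F.mapComp u g).hom := rfl

theorem hpaste_hom {a₁ a₂ a₃ b₁ b₂ b₃ : B} {f₁ : a₁ ⟶ b₁} {f₂ : a₂ ⟶ b₂} {f₃ : a₃ ⟶ b₃}
    {u : a₁ ⟶ a₂} {v : b₁ ⟶ b₂} {u' : a₂ ⟶ a₃} {v' : b₂ ⟶ b₃}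
    (p : f₁ ≫ v ≅ u ≫ f₂) (q : f₂ ≫ v' ≅ u' ≫ f₃) :
    (hpaste p q).hom = (α_ f₁ v v').inv ≫ p.hom ▷ v' ≫ (α_ u f₂ v').hom ≫ u ◁ q.hom ≫
      (α_ u u' f₃).inv := rfl

theorem map₂_α_inv (F : B ⥤ᵖ C) {a b c d : B} (f : a ⟶ b) (g : b ⟶ c) (h : c ⟶ d) :
    F.map₂ (α_ f g h).inv = (F.mapComp f (g ≫ h)).hom ≫ F.map f ◁ (F.mapComp g h).hom ≫
      (α_ _ _ _).inv ≫ (F.mapComp f g).inv ▷ F.map h ≫ (F.mapComp (f ≫ g) h).inv := by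
  simp [Pseudofunctor.mapComp_assoc_right_hom_assoc]

theorem mapSq_hpaste (F : B ⥤ᵖ C) {a₁ a₂ a₃ b₁ b₂ b₃ : B} {f₁ : a₁ ⟶ b₁} {f₂ : a₂ ⟶ b₂} {f₃ : a₃ ⟶ b₃}
    {u : a₁ ⟶ a₂} {v : b₁ ⟶ b₂} {u' : a₂ ⟶ a₃} {v' : b₂ ⟶ b₃}
    (p : f₁ ≫ v ≅ u ≫ f₂) (q : f₂ ≫ v' ≅ u' ≫ f₃) :
    F.map₂ (hpaste p q).hom = (F.mapComp f₁ (v ≫ v')).hom ≫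
      F.map f₁ ◁ (F.mapComp v v').hom ≫ (hpaste (mapSq F p) (mapSq F q)).hom ≫
      (F.mapComp u u').inv ▷ F.map f₃ ≫ (F.mapComp (u ≫ u') f₃).inv := by
  simp only [mapSq_hom, hpaste_hom, map₂_α_inv, PrelaxFunctor.map₂_comp, Pseudofunctor.map₂_associator, Pseudofunctor.map₂_whisker_left, Pseudofunctor.map₂_whisker_right]
  simp

variable {L : B ⥤ᵖ C} {U : C ⥤ᵖ B}

/-- Components of a transformation `Id ⟶ U ∘ L`. -/
def unitApp (η : Pseudofunctor.id B ⟶ L.comp U) (X : B) : X ⟶ U.obj (L.obj X) := η.app X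

/-- Pseudonaturality squares of a transformation `Id ⟶ U ∘ L`. -/
def unitSq (η : Pseudofunctor.id B ⟶ L.comp U) {X Y : B} (f : X ⟶ Y) :
    f ≫ unitApp η Y ≅ unitApp η X ≫ U.map (L.map f) := η.naturality f

/-- Components of a transformation `L ∘ U ⟶ Id`. -/
def counitApp (κ : U.comp L ⟶ Pseudofunctor.id C) (X : C) : L.obj (U.obj X) ⟶ X := κ.app X

/-- Pseudonaturality squares of a transformation `L ∘ U ⟶ Id`. -/
def counitSq (κ : U.comp L ⟶ Pseudofunctor.id C) {X Y : C} (f : X ⟶ Y) :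
    L.map (U.map f) ≫ counitApp κ Y ≅ counitApp κ X ≫ f := κ.naturality f

/-- A biadjunction `L ⊣ U`: pseudonatural unit and counit, together with invertible modifications
filling the two triangles (each given by its components and the modification axiom), subject to
the two swallowtail equations. Recall that `L.comp U` is `L` followed by `U`. -/
structure Biadjunction (L : B ⥤ᵖ C) (U : C ⥤ᵖ B) where
  unit : Pseudofunctor.id B ⟶ L.comp U
  counit : U.comp L ⟶ Pseudofunctor.id C
  leftTriangle (X : B) : 𝟙 (L.obj X) ≅ L.map (unitApp unit X) ≫ counitApp counit (L.obj X)
  leftTriangle_naturality {X Y : B} (f : X ⟶ Y) :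
    L.map f ◁ (leftTriangle Y).hom ≫
        (hpaste (mapSq L (unitSq unit f)) (counitSq counit (L.map f))).hom =
      ((ρ_ (L.map f)).hom ≫ (λ_ (L.map f)).inv) ≫ (leftTriangle X).hom ▷ L.map f
  rightTriangle (Y : C) : unitApp unit (U.obj Y) ≫ U.map (counitApp counit Y) ≅ 𝟙 (U.obj Y)
  rightTriangle_naturality {X Y : C} (g : X ⟶ Y) :
    U.map g ◁ (rightTriangle Y).hom ≫ ((ρ_ (U.map g)).hom ≫ (λ_ (U.map g)).inv) =
      (hpaste (unitSq unit (U.map g)) (mapSq U (counitSq counit g))).hom ≫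
        (rightTriangle X).hom ▷ U.map g
  swallowtail_unit (X : B) :
    unitApp unit X ◁ (rightTriangle (L.obj X)).hom =
      (α_ _ _ _).inv ≫
        (unitSq unit (unitApp unit X)).hom ▷ U.map (counitApp counit (L.obj X)) ≫
          (α_ _ _ _).hom ≫
            unitApp unit X ◁ ((U.mapComp _ _).inv ≫ U.map₂ (leftTriangle X).inv ≫
              (U.mapId (L.obj X)).hom)
  swallowtail_counit (Y : C) :
    ((L.mapComp _ _).inv ≫ L.map₂ (rightTriangle Y).hom ≫ (L.mapId (U.obj Y)).hom) ▷
        counitApp counit Y =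
      (α_ _ _ _).hom ≫
        L.map (unitApp unit (U.obj Y)) ◁ (counitSq counit (counitApp counit Y)).hom ≫
          (α_ _ _ _).inv ≫ (leftTriangle (U.obj Y)).inv ▷ counitApp counit Y

/-- Components of a transformation `Id ⟶ T`. -/
def monadUnitApp {T : B ⥤ᵖ B} (η : Pseudofunctor.id B ⟶ T) (X : B) : X ⟶ T.obj X := η.app X

/-- Pseudonaturality squares of a transformation `Id ⟶ T`. -/
def monadUnitSq {T : B ⥤ᵖ B} (η : Pseudofunctor.id B ⟶ T) {X Y : B} (f : X ⟶ Y) :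
    f ≫ monadUnitApp η Y ≅ monadUnitApp η X ≫ T.map f := η.naturality f

/-- Components of a transformation `T ∘ T ⟶ T`. -/
def multApp {T : B ⥤ᵖ B} (μ : T.comp T ⟶ T) (X : B) : T.obj (T.obj X) ⟶ T.obj X := μ.app X

/-- Pseudonaturality squares of a transformation `T ∘ T ⟶ T`. -/
def multSq {T : B ⥤ᵖ B} (μ : T.comp T ⟶ T) {X Y : B} (f : X ⟶ Y) :
    T.map (T.map f) ≫ multApp μ Y ≅ multApp μ X ≫ T.map f := μ.naturality f

/-- A pseudomonad: unit and multiplication pseudonatural transformations, and invertible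
modifications for the unit and associativity laws (each given by its components and the
modification axiom), subject to the two coherence equations. -/
structure Pseudomonad (B : Type u₁) [Bicategory.{w₁, v₁} B] where
  T : B ⥤ᵖ B
  unit : Pseudofunctor.id B ⟶ T
  mult : T.comp T ⟶ T
  leftUnit (X : B) : monadUnitApp unit (T.obj X) ≫ multApp mult X ≅ 𝟙 (T.obj X)
  leftUnit_naturality {X Y : B} (f : X ⟶ Y) :
    T.map f ◁ (leftUnit Y).hom ≫ ((ρ_ (T.map f)).hom ≫ (λ_ (T.map f)).inv) =
      (hpaste (monadUnitSq unit (T.map f)) (multSq mult f)).hom ≫ (leftUnit X).hom ▷ T.map f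
  rightUnit (X : B) : 𝟙 (T.obj X) ≅ T.map (monadUnitApp unit X) ≫ multApp mult X
  rightUnit_naturality {X Y : B} (f : X ⟶ Y) :
    T.map f ◁ (rightUnit Y).hom ≫
        (hpaste (mapSq T (monadUnitSq unit f)) (multSq mult f)).hom =
      ((ρ_ (T.map f)).hom ≫ (λ_ (T.map f)).inv) ≫ (rightUnit X).hom ▷ T.map f
  assoc (X : B) : T.map (multApp mult X) ≫ multApp mult X ≅
    multApp mult (T.obj X) ≫ multApp mult X
  assoc_naturality {X Y : B} (f : X ⟶ Y) :
    T.map (T.map (T.map f)) ◁ (assoc Y).hom ≫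
        (hpaste (multSq mult (T.map f)) (multSq mult f)).hom =
      (hpaste (mapSq T (multSq mult f)) (multSq mult f)).hom ≫
        (assoc X).hom ▷ T.map f
  coherence_unit (X : B) :
    T.map (monadUnitApp unit (T.obj X)) ◁ (assoc X).hom =
      (α_ _ _ _).inv ≫
        ((T.mapComp _ _).inv ≫ T.map₂ (leftUnit X).hom ≫ (T.mapId (T.obj X)).hom) ▷
          multApp mult X ≫
        (rightUnit (T.obj X)).hom ▷ multApp mult X ≫ (α_ _ _ _).hom
  coherence_assoc (X : B) :
    (α_ _ _ _).inv ≫ (mapSq T (assoc X)).hom ▷ multApp mult X ≫ (α_ _ _ _).hom ≫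
        T.map (multApp mult (T.obj X)) ◁ (assoc X).hom ≫
        (α_ _ _ _).inv ≫ (assoc (T.obj X)).hom ▷ multApp mult X ≫ (α_ _ _ _).hom =
      T.map (T.map (multApp mult X)) ◁ (assoc X).hom ≫
        (α_ _ _ _).inv ≫ (multSq mult (multApp mult X)).hom ▷ multApp mult X ≫
        (α_ _ _ _).hom ≫ multApp mult (T.obj (T.obj X)) ◁ (assoc X).hom

/-- An invertible modification `η T ≅ T η`. -/
structure Pseudomonad.IdempotencyData (M : Pseudomonad B) where
  iso (X : B) : monadUnitApp M.unit (M.T.obj X) ≅ M.T.map (monadUnitApp M.unit X)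
  naturality {X Y : B} (f : X ⟶ Y) :
    M.T.map f ◁ (iso Y).hom ≫ (mapSq M.T (monadUnitSq M.unit f)).hom =
      (monadUnitSq M.unit (M.T.map f)).hom ≫ (iso X).hom ▷ M.T.map (M.T.map f)

theorem counitSq_comp (κ : U.comp L ⟶ Pseudofunctor.id C) {X Y Z : C} (f : X ⟶ Y) (g : Y ⟶ Z) :
    (counitSq κ (f ≫ g)).hom =
      (L.map₂ (U.mapComp f g).hom ≫ (L.mapComp (U.map f) (U.map g)).hom) ▷ counitApp κ Z ≫
        (α_ _ _ _).hom ≫ L.map (U.map f) ◁ (counitSq κ g).hom ≫ (α_ _ _ _).inv ≫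
          (counitSq κ f).hom ▷ g ≫ (α_ _ _ _).hom := by
  have h := κ.naturality_comp f g
  have h' : (counitSq κ (f ≫ g)).hom ≫ counitApp κ X ◁ 𝟙 (f ≫ g) =
      (L.map₂ (U.mapComp f g).hom ≫ (L.mapComp (U.map f) (U.map g)).hom) ▷ counitApp κ Z ≫
        (α_ _ _ _).hom ≫ L.map (U.map f) ◁ (counitSq κ g).hom ≫ (α_ _ _ _).inv ≫
          (counitSq κ f).hom ▷ g ≫ (α_ _ _ _).hom := h
  simpa using h'

theorem counitSq_id (κ : U.comp L ⟶ Pseudofunctor.id C) (X : C) :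
    (counitSq κ (𝟙 X)).hom =
      (L.map₂ (U.mapId X).hom ≫ (L.mapId (U.obj X)).hom) ▷ counitApp κ X ≫
        (λ_ _).hom ≫ (ρ_ _).inv := by
  have h := κ.naturality_id X
  have h' : (counitSq κ (𝟙 X)).hom ≫ counitApp κ X ◁ 𝟙 (𝟙 X) =
      (L.map₂ (U.mapId X).hom ≫ (L.mapId (U.obj X)).hom) ▷ counitApp κ X ≫
        (λ_ _).hom ≫ (ρ_ _).inv := h
  simpa using h'

theorem counitSq_naturality (κ : U.comp L ⟶ Pseudofunctor.id C) {X Y : C} {f g : X ⟶ Y}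
    (θ : f ⟶ g) :
    L.map₂ (U.map₂ θ) ▷ counitApp κ Y ≫ (counitSq κ g).hom =
      (counitSq κ f).hom ≫ counitApp κ X ◁ θ :=
  κ.naturality_naturality θ

theorem map₂_inv_hom_whisker (F : B ⥤ᵖ C) {a b : B} {f g : a ⟶ b} (i : f ≅ g) {c : C}
    (h : F.obj b ⟶ c) {k : F.obj a ⟶ c} (θ : F.map g ≫ h ⟶ k) :
    F.map₂ i.inv ▷ h ≫ F.map₂ i.hom ▷ h ≫ θ = θ := by
  rw [← Category.assoc, ← comp_whiskerRight, ← PrelaxFunctor.map₂_comp]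
  simp

theorem map₂_ρ_inv (F : B ⥤ᵖ C) {a b : B} (f : a ⟶ b) :
    F.map₂ (ρ_ f).inv = (ρ_ (F.map f)).inv ≫ F.map f ◁ (F.mapId b).inv ≫
      (F.mapComp f (𝟙 b)).inv := by
  rw [← cancel_epi (F.map₂ (ρ_ f).hom), ← PrelaxFunctor.map₂_comp, Iso.hom_inv_id]
  simp

theorem map₂_lam_inv (F : B ⥤ᵖ C) {a b : B} (f : a ⟶ b) :
    F.map₂ (λ_ f).inv = (λ_ (F.map f)).inv ≫ (F.mapId a).inv ▷ F.map f ≫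
      (F.mapComp (𝟙 a) f).inv := by
  rw [← cancel_epi (F.map₂ (λ_ f).hom), ← PrelaxFunctor.map₂_comp, Iso.hom_inv_id]
  simp

theorem counitSq_counitSq (κ : U.comp L ⟶ Pseudofunctor.id C) {X Y : C} (g : X ⟶ Y) :
    L.map (U.map (L.map (U.map g))) ◁ (counitSq κ (counitApp κ Y)).hom ≫
        (hpaste (counitSq κ (L.map (U.map g))) (counitSq κ g)).hom =
      (hpaste (mapSq L (mapSq U (counitSq κ g))) (counitSq κ g)).hom ≫
        (counitSq κ (counitApp κ X)).hom ▷ g := by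
  have h := counitSq_naturality κ (counitSq κ g).hom
  rw [counitSq_comp, counitSq_comp] at h
  have h2 := (α_ (L.map (U.map (L.map (U.map g)))) (L.map (U.map (counitApp κ Y))) (counitApp κ Y)).inv ≫=
    ((L.mapComp (U.map (L.map (U.map g))) (U.map (counitApp κ Y))).inv ≫
      L.map₂ (U.mapComp (L.map (U.map g)) (counitApp κ Y)).inv) ▷ counitApp κ Y ≫= h =≫ (α_ _ _ _).inv
  simp only [mapSq_hom, hpaste_hom, PrelaxFunctor.map₂_comp, comp_whiskerRight, Category.assoc] at h2 ⊢
  simp [map₂_inv_hom_whisker] at h2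
  simp [h2]

theorem map_counitSq_counitSq (κ : U.comp L ⟶ Pseudofunctor.id C) {X Y : C} (g : X ⟶ Y) :
    U.map (L.map (U.map (L.map (U.map g)))) ◁ (mapSq U (counitSq κ (counitApp κ Y))).hom ≫
        (hpaste (mapSq U (counitSq κ (L.map (U.map g)))) (mapSq U (counitSq κ g))).hom =
      (hpaste (mapSq U (mapSq L (mapSq U (counitSq κ g)))) (mapSq U (counitSq κ g))).hom ≫
        (mapSq U (counitSq κ (counitApp κ X))).hom ▷ U.map g := by
  have h := congrArg U.map₂ (counitSq_counitSq κ g)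
  simp only [PrelaxFunctor.map₂_comp, mapSq_hpaste, Pseudofunctor.map₂_whisker_left, Pseudofunctor.map₂_whisker_right] at h
  have h2 := (_ ◁ (U.mapComp _ _).inv ≫= ((U.mapComp _ _).inv ≫= (h =≫ (U.mapComp _ _).hom))) =≫
    (U.mapComp _ _).hom ▷ _
  simp only [mapSq_hom (F := U) (p := counitSq κ (counitApp κ _)), whiskerLeft_comp, comp_whiskerRight, Category.assoc]
  simpa using h2

theorem mapSq_comp (F : B ⥤ᵖ C) (G : C ⥤ᵖ D) {a a' b b' : B} {f : a ⟶ b} {v : b ⟶ b'} {u : a ⟶ a'}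
    {g : a' ⟶ b'} (p : f ≫ v ≅ u ≫ g) : mapSq (F.comp G) p = mapSq G (mapSq F p) := by
  ext
  have h : ((G.mapComp (F.map f) (F.map v)).inv ≫ G.map₂ (F.mapComp f v).inv) ≫
      G.map₂ (F.map₂ p.hom) ≫ (G.map₂ (F.mapComp u g).hom ≫ (G.mapComp _ _).hom) =
    (G.mapComp _ _).inv ≫ G.map₂ ((F.mapComp f v).inv ≫ F.map₂ p.hom ≫ (F.mapComp u g).hom) ≫
      (G.mapComp _ _).hom := by simp
  exact h

theorem mapSq_naturality {a a' b b' : B} (F : B ⥤ᵖ C) {f f' : a ⟶ b} {v : b ⟶ b'} {u : a ⟶ a'} {g g' : a' ⟶ b'}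
    (p : f ≫ v ≅ u ≫ g) (p' : f' ≫ v ≅ u ≫ g') (θ : f ⟶ f') (θ' : g ⟶ g')
    (h : θ ▷ v ≫ p'.hom = p.hom ≫ u ◁ θ') :
    F.map₂ θ ▷ F.map v ≫ (mapSq F p').hom = (mapSq F p).hom ≫ F.map u ◁ F.map₂ θ' := by
  have h := congrArg F.map₂ h
  simp only [PrelaxFunctor.map₂_comp, Pseudofunctor.map₂_whisker_left,
    Pseudofunctor.map₂_whisker_right] at h
  have h2 := (F.mapComp _ _).inv ≫= h =≫ (F.mapComp _ _).hom
  simpa [mapSq_hom] using h2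

/-- The multiplication `U ε L` of the pseudomonad of a biadjunction. -/
def monadMult (κ : U.comp L ⟶ Pseudofunctor.id C) : (L.comp U).comp (L.comp U) ⟶ L.comp U where
  app X := U.map (counitApp κ (L.obj X))
  naturality f := mapSq U (counitSq κ (L.map f))
  naturality_naturality {X Y f g} θ :=
    mapSq_naturality U _ _ _ _ (counitSq_naturality κ (L.map₂ θ))
  naturality_id X := by
    have h : (mapSq U (counitSq κ (L.map (𝟙 X)))).hom ≫ U.map (counitApp κ (L.obj X)) ◁
        (U.map₂ (L.mapId X).hom ≫ (U.mapId (L.obj X)).hom) =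
        (U.map₂ (L.map₂ (U.map₂ (L.mapId X).hom ≫ (U.mapId (L.obj X)).hom)) ≫
          (U.map₂ (L.mapId (U.obj (L.obj X))).hom ≫ (U.mapId (L.obj (U.obj (L.obj X)))).hom)) ▷
            U.map (counitApp κ (L.obj X)) ≫ (λ_ _).hom ≫ (ρ_ _).inv := by
      have e := mapSq_naturality U _ _ _ _ (counitSq_naturality κ (L.mapId X).hom)
      have e2 := congrArg U.map₂ (counitSq_id κ (L.obj X))
      rw [whiskerLeft_comp, ← Category.assoc, ← e]
      simp only [mapSq_hom, e2]
      simp [map₂_ρ_inv]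
    exact h
  naturality_comp {X Y Z} f g := by
    have h : (mapSq U (counitSq κ (L.map (f ≫ g)))).hom ≫ U.map (counitApp κ (L.obj X)) ◁
        (U.map₂ (L.mapComp f g).hom ≫ (U.mapComp (L.map f) (L.map g)).hom) =
        (U.map₂ (L.map₂ (U.map₂ (L.mapComp f g).hom ≫ (U.mapComp (L.map f) (L.map g)).hom)) ≫
          (U.map₂ (L.mapComp (U.map (L.map f)) (U.map (L.map g))).hom ≫
            (U.mapComp (L.map (U.map (L.map f))) (L.map (U.map (L.map g)))).hom)) ▷
            U.map (counitApp κ (L.obj Z)) ≫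
          (α_ _ _ _).hom ≫ U.map (L.map (U.map (L.map f))) ◁ (mapSq U (counitSq κ (L.map g))).hom ≫
          (α_ _ _ _).inv ≫ (mapSq U (counitSq κ (L.map f))).hom ▷ U.map (L.map g) ≫
            (α_ _ _ _).hom := by
      have e := mapSq_naturality U _ _ _ _ (counitSq_naturality κ (L.mapComp f g).hom)
      have e2 := congrArg U.map₂ (counitSq_comp κ (L.map f) (L.map g))
      rw [whiskerLeft_comp, ← Category.assoc, ← e]
      simp only [mapSq_hom, e2]
      simp [map₂_α_inv]
    exact h

namespace Biadjunction

theorem pseudomonad_rightUnit (adj : Biadjunction L U) {X Y : B} (f : X ⟶ Y) :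
    U.map (L.map f) ◁ ((U.mapId (L.obj Y)).inv ≫ U.map₂ (adj.leftTriangle Y).hom ≫
        (U.mapComp (L.map (unitApp adj.unit Y)) (counitApp adj.counit (L.obj Y))).hom) ≫
        (hpaste (mapSq U (mapSq L (unitSq adj.unit f)))
          (mapSq U (counitSq adj.counit (L.map f)))).hom =
      ((ρ_ (U.map (L.map f))).hom ≫ (λ_ (U.map (L.map f))).inv) ≫
        ((U.mapId (L.obj X)).inv ≫ U.map₂ (adj.leftTriangle X).hom ≫
        (U.mapComp (L.map (unitApp adj.unit X)) (counitApp adj.counit (L.obj X))).hom) ▷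
          U.map (L.map f) := by
  have h := congrArg U.map₂ (adj.leftTriangle_naturality f)
  simp only [PrelaxFunctor.map₂_comp, mapSq_hpaste, Pseudofunctor.map₂_whisker_left,
    Pseudofunctor.map₂_whisker_right] at h
  have h2 := (U.map (L.map f) ◁ (U.mapId (L.obj Y)).inv ≫= ((U.mapComp _ _).inv ≫=
    (h =≫ (U.mapComp _ _).hom))) =≫ (U.mapComp _ _).hom ▷ _
  simp [map₂_lam_inv] at h2
  simp [h2]

theorem pseudomonad_coherence_unit (adj : Biadjunction L U) (Y : C) :
    U.map (L.map (unitApp adj.unit (U.obj Y))) ◁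
        (mapSq U (counitSq adj.counit (counitApp adj.counit Y))).hom =
      (α_ _ _ _).inv ≫
        (((U.mapComp _ _).inv ≫ U.map₂ (L.mapComp _ _).inv) ≫
          U.map₂ (L.map₂ (adj.rightTriangle Y).hom) ≫
            (U.map₂ (L.mapId (U.obj Y)).hom ≫ (U.mapId _).hom)) ▷
          U.map (counitApp adj.counit Y) ≫
        ((U.mapId _).inv ≫ U.map₂ (adj.leftTriangle (U.obj Y)).hom ≫ (U.mapComp _ _).hom) ▷
          U.map (counitApp adj.counit Y) ≫ (α_ _ _ _).hom := by
  have h := congrArg U.map₂ ((adj.swallowtail_counit Y) =≫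
    (adj.leftTriangle (U.obj Y)).hom ▷ counitApp adj.counit Y)
  simp only [PrelaxFunctor.map₂_comp, Pseudofunctor.map₂_whisker_left,
    Pseudofunctor.map₂_whisker_right, comp_whiskerRight, Category.assoc, map₂_α_inv,
    Pseudofunctor.map₂_associator] at h
  have h2 := (U.mapComp _ _).inv ≫= (h =≫ (U.mapComp _ _).hom)
  simp at h2
  have h3 := ((α_ _ _ _).inv ≫= ((U.mapComp _ _).inv ▷ _ ≫= (h2 =≫ (U.mapComp _ _).hom ▷ _))) =≫
    (α_ _ _ _).hom
  simp [map₂_inv_hom_whisker] at h3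
  simp [mapSq_hom, h3]

theorem pseudomonad_coherence_assoc (κ : U.comp L ⟶ Pseudofunctor.id C) {X Y : C} (g : X ⟶ Y) :
    (α_ _ _ _).inv ≫ (mapSq U (mapSq L (mapSq U (counitSq κ g)))).hom ▷ U.map (counitApp κ Y) ≫
        (α_ _ _ _).hom ≫ U.map (L.map (U.map (counitApp κ X))) ◁ (mapSq U (counitSq κ g)).hom ≫
        (α_ _ _ _).inv ≫ (mapSq U (counitSq κ (counitApp κ X))).hom ▷ U.map g ≫ (α_ _ _ _).hom =
      U.map (L.map (U.map (L.map (U.map g)))) ◁ (mapSq U (counitSq κ (counitApp κ Y))).hom ≫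
        (α_ _ _ _).inv ≫
          (mapSq U (counitSq κ (L.map (U.map g)))).hom ▷ U.map (counitApp κ Y) ≫
        (α_ _ _ _).hom ≫
          U.map (counitApp κ (L.obj (U.obj X))) ◁ (mapSq U (counitSq κ g)).hom := by
  have h := map_counitSq_counitSq κ g =≫ (α_ _ _ _).hom
  simp only [hpaste_hom, Category.assoc, Iso.inv_hom_id, Category.comp_id] at h
  exact h.symm

/-- The pseudomonad `(U ∘ L, η, U ε L)` induced by a biadjunction `L ⊣ U`. -/
def pseudomonad (adj : Biadjunction L U) : Pseudomonad B where
  T := L.comp U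
  unit := adj.unit
  mult := monadMult adj.counit
  leftUnit X := adj.rightTriangle (L.obj X)
  leftUnit_naturality f := adj.rightTriangle_naturality (L.map f)
  rightUnit X := (U.mapId (L.obj X)).symm ≪≫ U.map₂Iso (adj.leftTriangle X) ≪≫ U.mapComp _ _
  rightUnit_naturality {X Y} f := by
    refine (congrArg (fun z => U.map (L.map f) ◁ ((U.mapId (L.obj Y)).inv ≫
      U.map₂ (adj.leftTriangle Y).hom ≫
        (U.mapComp (L.map (unitApp adj.unit Y)) (counitApp adj.counit (L.obj Y))).hom) ≫
        (hpaste z (mapSq U (counitSq adj.counit (L.map f)))).hom) ?_).trans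
      (adj.pseudomonad_rightUnit f)
    exact mapSq_comp L U (unitSq adj.unit f)
  assoc X := mapSq U (counitSq adj.counit (counitApp adj.counit (L.obj X)))
  assoc_naturality {X Y} f := by
    refine (map_counitSq_counitSq adj.counit (L.map f)).trans (congrArg (fun z => (hpaste z
      (mapSq U (counitSq adj.counit (L.map f)))).hom ≫
        (mapSq U (counitSq adj.counit (counitApp adj.counit (L.obj X)))).hom ▷ U.map (L.map f))
        ?_)
    exact (mapSq_comp L U (mapSq U (counitSq adj.counit (L.map f)))).symm
  coherence_unit X := adj.pseudomonad_coherence_unit (L.obj X)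
  coherence_assoc X := by
    refine (congrArg (fun z => (α_ _ _ _).inv ≫ Iso.hom z ▷ U.map (counitApp adj.counit (L.obj X)) ≫
      (α_ _ _ _).hom ≫ U.map (L.map (U.map (counitApp adj.counit (L.obj (U.obj (L.obj X)))))) ◁
        (mapSq U (counitSq adj.counit (counitApp adj.counit (L.obj X)))).hom ≫
      (α_ _ _ _).inv ≫ (mapSq U (counitSq adj.counit
        (counitApp adj.counit (L.obj (U.obj (L.obj X)))))).hom ▷
          U.map (counitApp adj.counit (L.obj X)) ≫ (α_ _ _ _).hom) ?_).trans
      (pseudomonad_coherence_assoc adj.counit (counitApp adj.counit (L.obj X)))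
    exact mapSq_comp L U (mapSq U (counitSq adj.counit (counitApp adj.counit (L.obj X))))

end Biadjunction

/-- A pseudomonad is idempotent if there is an invertible modification `η T ≅ T η`. -/
def Pseudomonad.IsIdempotent (M : Pseudomonad B) : Prop := Nonempty M.IdempotencyData

/-- A pseudoalgebra structure on `X` for an (idempotent) pseudomonad: a left adjoint
`act : T X ⟶ X` to the unit component `η_X : X ⟶ T X` such that the unit and the counit of the
adjunction are invertible; that is, `act` and `η_X` form an adjoint equivalence. -/
structure Pseudomonad.PseudoalgebraStructure (M : Pseudomonad B) (X : B) where
  act : M.T.obj X ⟶ X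
  adjUnit : 𝟙 (M.T.obj X) ≅ act ≫ monadUnitApp M.unit X
  adjCounit : monadUnitApp M.unit X ≫ act ≅ 𝟙 X
  triangle : leftZigzagIso adjUnit adjCounit = λ_ act ≪≫ (ρ_ act).symm

/-- The object `X` can be endowed with a pseudoalgebra structure. -/
def Pseudomonad.AdmitsPseudoalgebra (M : Pseudomonad B) (X : B) : Prop :=
  Nonempty (M.PseudoalgebraStructure X)

/-- The universal property of the right pseudo-Kan extension `R` of `A` along `t`, with
universal transformation `κ : R ∘ t ⟶ A`: for every `S : C ⥤ᵖ D`, the functor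
`[C, D]_PS(S, R) ⥤ [B, D]_PS(S ∘ t, A)` that sends `α` to `κ · (α t)` is an equivalence. -/
def IsRightPseudoKan (t : B ⥤ᵖ C) (A : B ⥤ᵖ D) (R : C ⥤ᵖ D) (κ : t.comp R ⟶ A) : Prop :=
  ∀ S : C ⥤ᵖ D,
    ((precomp t D).mapFunctor S R ⋙ (postcomposing (t.comp S) (t.comp R) A).obj κ).IsEquivalence

end

section

variable {B : Type u₁} [Bicategory.{w₁, v₁} B] {C : Type u₂} [Bicategory.{w₂, v₂} C]
  {D : Type u₃} [Bicategory.{w₃, v₃} D] {E : Type u₄} [Bicategory.{w₄, v₄} E]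

/-- Components of a transformation `R ∘ t ⟶ A`. -/
def kanApp {t : B ⥤ᵖ C} {R : C ⥤ᵖ D} {A : B ⥤ᵖ D} (κ : t.comp R ⟶ A) (b : B) :
    R.obj (t.obj b) ⟶ A.obj b := κ.app b

/-- Pseudonaturality squares of a transformation `R ∘ t ⟶ A`. -/
def kanSq {t : B ⥤ᵖ C} {R : C ⥤ᵖ D} {A : B ⥤ᵖ D} (κ : t.comp R ⟶ A) {a b : B} (f : a ⟶ b) :
    R.map (t.map f) ≫ kanApp κ b ≅ kanApp κ a ≫ A.map f := κ.naturality f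

theorem kanSq_naturality {t : B ⥤ᵖ C} {R : C ⥤ᵖ D} {A : B ⥤ᵖ D} (κ : t.comp R ⟶ A) {a b : B}
    {f g : a ⟶ b} (θ : f ⟶ g) :
    R.map₂ (t.map₂ θ) ▷ kanApp κ b ≫ (kanSq κ g).hom =
      (kanSq κ f).hom ≫ kanApp κ a ◁ A.map₂ θ :=
  κ.naturality_naturality θ

theorem kanSq_id {t : B ⥤ᵖ C} {R : C ⥤ᵖ D} {A : B ⥤ᵖ D} (κ : t.comp R ⟶ A) (a : B) :
    (R.map₂ (t.mapId a).hom ≫ (R.mapId (t.obj a)).hom) ▷ kanApp κ a ≫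
        (λ_ (kanApp κ a) ≪≫ (ρ_ (kanApp κ a)).symm).hom =
      (kanSq κ (𝟙 a)).hom ≫ kanApp κ a ◁ (A.mapId a).hom :=
  (κ.naturality_id a).symm

theorem kanSq_comp {t : B ⥤ᵖ C} {R : C ⥤ᵖ D} {A : B ⥤ᵖ D} (κ : t.comp R ⟶ A) {a b c : B}
    (f : a ⟶ b) (g : b ⟶ c) :
    (R.map₂ (t.mapComp f g).hom ≫ (R.mapComp (t.map f) (t.map g)).hom) ▷ kanApp κ c ≫
        ((α_ _ _ _) ≪≫ whiskerLeftIso (R.map (t.map f)) (kanSq κ g) ≪≫ (α_ _ _ _).symm ≪≫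
          whiskerRightIso (kanSq κ f) (A.map g) ≪≫ (α_ _ _ _)).hom =
      (kanSq κ (f ≫ g)).hom ≫ kanApp κ a ◁ (A.mapComp f g).hom :=
  (κ.naturality_comp f g).symm

/-- The transformation `G R t ⟶ G A` obtained from `κ : R t ⟶ A` by applying `G`. -/
def postWhisker (t : B ⥤ᵖ C) {R : C ⥤ᵖ D} {A : B ⥤ᵖ D} (κ : t.comp R ⟶ A) (G : D ⥤ᵖ E) :
    t.comp (R.comp G) ⟶ A.comp G where
  app b := G.map (kanApp κ b)
  naturality f := mapSq G (kanSq κ f)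
  naturality_naturality θ := mapSq_naturality G _ _ _ _ (kanSq_naturality κ θ)
  naturality_id a := by
    have h : (mapSq G (kanSq κ (𝟙 a))).hom ≫ G.map (kanApp κ a) ◁
        (G.map₂ (A.mapId a).hom ≫ (G.mapId (A.obj a)).hom) =
        (G.map₂ (R.map₂ (t.mapId a).hom) ≫ (G.map₂ (R.mapId (t.obj a)).hom ≫
          (G.mapId (R.obj (t.obj a))).hom)) ▷ G.map (kanApp κ a) ≫ (λ_ _).hom ≫ (ρ_ _).inv := by
      rw [whiskerLeft_comp, ← Category.assoc, ← mapSq_naturality G _ _ _ _ (kanSq_id κ a)]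
      simp only [mapSq_hom, Iso.trans_hom, Iso.symm_hom, PrelaxFunctor.map₂_comp, map₂_ρ_inv]
      simp
    exact h
  naturality_comp {a b c} f g := by
    have h : (mapSq G (kanSq κ (f ≫ g))).hom ≫ G.map (kanApp κ a) ◁
        (G.map₂ (A.mapComp f g).hom ≫ (G.mapComp (A.map f) (A.map g)).hom) =
        (G.map₂ (R.map₂ (t.mapComp f g).hom) ≫ (G.map₂ (R.mapComp (t.map f) (t.map g)).hom ≫
          (G.mapComp (R.map (t.map f)) (R.map (t.map g))).hom)) ▷ G.map (kanApp κ c) ≫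
          (α_ _ _ _).hom ≫ G.map (R.map (t.map f)) ◁ (mapSq G (kanSq κ g)).hom ≫
          (α_ _ _ _).inv ≫ (mapSq G (kanSq κ f)).hom ▷ G.map (A.map g) ≫ (α_ _ _ _).hom := by
      rw [whiskerLeft_comp, ← Category.assoc, ← mapSq_naturality G _ _ _ _ (kanSq_comp κ f g)]
      simp only [mapSq_hom, Iso.trans_hom, Iso.symm_hom, PrelaxFunctor.map₂_comp, map₂_α_inv,
        whiskerLeftIso_hom, whiskerRightIso_hom]
      simp
    exact h

end

section

variable {B : Type u₁} [Bicategory.{w₁, v₁} B] {C : Type u₂} [Bicategory.{w₂, v₂} C]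
  {D : Type u₃} [Bicategory.{w₃, v₃} D]

/-- A global right pseudo-Kan extension along `t` with respect to `D`: a right biadjoint
`PsRan_t` of `[t, D]_PS`. -/
structure GlobalPseudoKan (t : B ⥤ᵖ C) (D : Type u₃) [Bicategory.{w₃, v₃} D] where
  ran : (B ⥤ᵖ D) ⥤ᵖ (C ⥤ᵖ D)
  adj : Biadjunction (precomp t D) ran

namespace GlobalPseudoKan

/-- The pseudomonad `⟨t⟩ = PsRan_t (- ∘ t)` on `[C, D]_PS`. -/
def pseudomonad {t : B ⥤ᵖ C} (K : GlobalPseudoKan t D) : Pseudomonad (C ⥤ᵖ D) :=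
  K.adj.pseudomonad

/-- `A` is of effective `t`-descent if it can be endowed with a `⟨t⟩`-pseudoalgebra structure. -/
def IsEffectiveDescent {t : B ⥤ᵖ C} (K : GlobalPseudoKan t D) (A : C ⥤ᵖ D) : Prop :=
  K.pseudomonad.AdmitsPseudoalgebra A

/-- The global pseudo-Kan extension is pointwise: each extension `(PsRan_t A, κ)` of
`A : B ⥤ᵖ D` is preserved by all representables `D(Z, -)`, where `κ` is the counit at `A`. -/
def IsPointwise {C : Type u₂} [Bicategory.{w₃, v₃} C] {t : B ⥤ᵖ C}
    (K : GlobalPseudoKan t D) : Prop :=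
  ∀ (A : B ⥤ᵖ D) (Z : D),
    IsRightPseudoKan t (A.comp (representable Z)) ((K.ran.obj A).comp (representable Z))
      (postWhisker t (counitApp K.adj.counit A) (representable Z))

end GlobalPseudoKan

/-- A 2-functor `t` is an `x`-inclusion: it is injective on objects, an isomorphism on
hom-categories, and the objects of its codomain are the disjoint union of those of its domain
and `{x}`. -/
structure IsOneObjectInclusion (t : StrictPseudofunctor B C) (x : C) : Prop where
  obj_injective : Function.Injective t.obj
  obj_ne (b : B) : t.obj b ≠ x
  obj_eq (c : C) : c = x ∨ ∃ b, t.obj b = c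
  map_bijective (a b : B) : Function.Bijective (fun f : a ⟶ b => t.map f)
  map₂_bijective {a b : B} (f g : a ⟶ b) : Function.Bijective (fun θ : f ⟶ g => t.map₂ θ)

end

end PsDescent

/-! Both parts come from one argument about retractions. Let `η : Id ⟶ T` be the unit of a
pseudomonad with `η T ≅ T η` objectwise. If `η_X` has a retraction `r`, it is an equivalence, since
`r ≫ η_X ≅ η_{TX} ≫ T r ≅ T η_X ≫ T r ≅ 𝟙` (`isEquiv_monadUnitApp_of_retract`). So it is enough to
find a retraction of `η` at `A(a)`. Whiskering gives a transformation `η A : A ⟶ T A`. After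
restriction along `t` its components are equivalences, and pointwise inverses assemble, as mates,
into a pseudonatural inverse (`exists_rightInverse`). Effective descent makes `A` a retract of the
extension of its restriction. Pseudonaturality of the unit of the biadjunction then carries the
inverse of the restricted `η A` to a retraction of `η A` itself
(`Biadjunction.exists_rightInverse`), which is evaluated at `a`. This is (i). For (ii) the same
argument is applied to `⟨h⟩` on `[𝔹', H]`, once `η T ≅ T η` is known for it. The counit of a
pointwise extension along a local equivalence consists of equivalences: by the bicategorical Yoneda
lemma, a `Cat`-valued extension has universal components that are bijective on isomorphism classes
of objects, and preservation by the representables at two well-chosen objects turns this into an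
inverse. Hence the multiplication has a right inverse, and `η T` and `T η`, both sections of it, are
isomorphic. -/

namespace PsDescent

/-! ### Pointwise adjoint inverses of a pseudonatural transformation, via mates. -/

section PointwiseInverse

variable {B : Type u₁} [Bicategory.{w₁, v₁} B] {C : Type u₂} [Bicategory.{w₂, v₂} C]
  {F G : B ⥤ᵖ C} (α : F ⟶ G) (g : ∀ b, G.obj b ⟶ F.obj b)
  (e : ∀ b, 𝟙 (F.obj b) ≅ α.app b ≫ g b) (k : ∀ b, g b ≫ α.app b ≅ 𝟙 (G.obj b))

/-- The pseudonaturality squares of a pointwise inverse of `α`, obtained as mates. -/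
def invSq {a b : B} (f : a ⟶ b) : G.map f ≫ g b ≅ g a ≫ F.map f :=
  Iso.refl _ ≪⊗≫ whiskerRightIso (k a).symm (G.map f ≫ g b) ≪⊗≫
    whiskerLeftIso (g a) (whiskerRightIso (α.naturality f).symm (g b)) ≪⊗≫
      whiskerLeftIso (g a ≫ F.map f) (e b).symm ≪⊗≫ Iso.refl (g a ≫ F.map f)

theorem invSq_hom {a b : B} (f : a ⟶ b) : (invSq α g e k f).hom =
    𝟙 _ ⊗≫ (k a).inv ▷ (G.map f ≫ g b) ⊗≫ g a ◁ (α.naturality f).inv ▷ g b ⊗≫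
      (g a ≫ F.map f) ◁ (e b).inv ⊗≫ 𝟙 (g a ≫ F.map f) := by
  simp [invSq, bicategoricalComp, bicategoricalIsoComp]

/-- Naturality in 2-cells needs only interchange and the naturality of `α`; the triangle identity
enters first for identities and composites. -/
theorem invSq_naturality {a b : B} {f f' : a ⟶ b} (θ : f ⟶ f') :
    G.map₂ θ ▷ g b ≫ (invSq α g e k f').hom = (invSq α g e k f).hom ≫ g a ◁ F.map₂ θ := by
  have h : α.app a ◁ G.map₂ θ ≫ (α.naturality f').inv =
      (α.naturality f).inv ≫ F.map₂ θ ▷ α.app b := by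
    rw [Iso.comp_inv_eq, Category.assoc, Iso.eq_inv_comp, α.naturality_naturality]
  rw [invSq_hom, invSq_hom]
  calc
    _ = 𝟙 _ ⊗≫ (𝟙 _ ◁ (G.map₂ θ ▷ g b) ≫ (k a).inv ▷ (G.map f' ≫ g b)) ⊗≫
          g a ◁ (α.naturality f').inv ▷ g b ⊗≫ (g a ≫ F.map f') ◁ (e b).inv ⊗≫ 𝟙 _ := by
      bicategory
    _ = 𝟙 _ ⊗≫ (k a).inv ▷ (G.map f ≫ g b) ⊗≫
          g a ◁ (α.app a ◁ G.map₂ θ ≫ (α.naturality f').inv) ▷ g b ⊗≫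
            (g a ≫ F.map f') ◁ (e b).inv ⊗≫ 𝟙 _ := by
      rw [whisker_exchange]; bicategory
    _ = 𝟙 _ ⊗≫ (k a).inv ▷ (G.map f ≫ g b) ⊗≫ g a ◁ (α.naturality f).inv ▷ g b ⊗≫
          g a ◁ (F.map₂ θ ▷ (α.app b ≫ g b) ≫ F.map f' ◁ (e b).inv) ⊗≫ 𝟙 _ := by
      rw [h]; bicategory
    _ = _ := by
      rw [← whisker_exchange]; bicategory

/-- Inverting the 2-cells of `f ⊣ g` yields an adjunction `g ⊣ f` with unit `k.inv` and counit
`e.inv`. This and the next lemma are its two triangle identities, the ones that mates along `α`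
require. -/
theorem zigzag_inv {a b : C} {f : a ⟶ b} {g : b ⟶ a} (e : 𝟙 a ≅ f ≫ g) (k : g ≫ f ≅ 𝟙 b)
    (tri : leftZigzag e.hom k.hom = (λ_ f).hom ≫ (ρ_ f).inv) :
    k.inv ▷ g ⊗≫ g ◁ e.inv = (λ_ g).hom ≫ (ρ_ g).inv := by
  have h := right_triangle_of_left_triangle e k tri
  have h2 := congrArg Iso.inv (show rightZigzagIso e k = ρ_ g ≪≫ (λ_ g).symm from Iso.ext h)
  rw [rightZigzagIso_inv] at h2
  simpa [leftZigzag] using h2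

theorem zigzag_inv' {a b : C} {f : a ⟶ b} {g : b ⟶ a} (e : 𝟙 a ≅ f ≫ g) (k : g ≫ f ≅ 𝟙 b)
    (tri : leftZigzag e.hom k.hom = (λ_ f).hom ≫ (ρ_ f).inv) :
    f ◁ k.inv ⊗≫ e.inv ▷ f = (ρ_ f).hom ≫ (λ_ f).inv := by
  have h2 := congrArg Iso.inv (show leftZigzagIso e k = λ_ f ≪≫ (ρ_ f).symm from Iso.ext tri)
  rw [leftZigzagIso_inv] at h2
  simpa [rightZigzag] using h2

/-- Over an identity the square of `α` reduces to unitors, so its mate collapses to the zigzag on `g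
a`. -/
theorem invSq_id
    (tri : ∀ b, leftZigzag (e b).hom (k b).hom = (λ_ (α.app b)).hom ≫ (ρ_ (α.app b)).inv)
    (a : B) : (invSq α g e k (𝟙 a)).hom ≫ g a ◁ (F.mapId a).hom =
    (G.mapId a).hom ▷ g a ≫ (λ_ (g a)).hom ≫ (ρ_ (g a)).inv := by
  rw [invSq_hom, Pseudofunctor.StrongTrans.naturality_id_inv]
  calc
    _ = 𝟙 _ ⊗≫ ((k a).inv ▷ (G.map (𝟙 a) ≫ g a) ≫ (g a ≫ α.app a) ◁ (G.mapId a).hom ▷ g a) ⊗≫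
          g a ◁ ((F.mapId a).inv ▷ (α.app a ≫ g a) ≫ F.map (𝟙 a) ◁ (e a).inv) ⊗≫
            g a ◁ (F.mapId a).hom ⊗≫ 𝟙 _ := by
      bicategory
    _ = 𝟙 _ ⊗≫ (G.mapId a).hom ▷ g a ⊗≫ ((k a).inv ▷ g a ⊗≫ g a ◁ (e a).inv) ⊗≫
          g a ◁ ((F.mapId a).inv ≫ (F.mapId a).hom) ⊗≫ 𝟙 _ := by
      rw [← whisker_exchange, ← whisker_exchange]; bicategory
    _ = _ := by
      rw [zigzag_inv _ _ (tri a), Iso.inv_hom_id]; bicategory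

/-- Pasting two mates leaves `(k b).inv` followed by `(e b).inv` at the middle object. Interchange
brings them together on `α.app b`, where the zigzag cancels them. -/
theorem invSq_comp
    (tri : ∀ b, leftZigzag (e b).hom (k b).hom = (λ_ (α.app b)).hom ≫ (ρ_ (α.app b)).inv)
    {a b c : B} (f : a ⟶ b) (f' : b ⟶ c) :
    (invSq α g e k (f ≫ f')).hom ≫ g a ◁ (F.mapComp f f').hom =
      (G.mapComp f f').hom ▷ g c ≫ (α_ _ _ _).hom ≫ G.map f ◁ (invSq α g e k f').hom ≫
        (α_ _ _ _).inv ≫ (invSq α g e k f).hom ▷ F.map f' ≫ (α_ _ _ _).hom := by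
  simp only [invSq_hom, Pseudofunctor.StrongTrans.naturality_comp_inv]
  symm
  calc
    _ = 𝟙 _ ⊗≫ (G.mapComp f f').hom ▷ g c ⊗≫ G.map f ◁ (k b).inv ▷ (G.map f' ≫ g c) ⊗≫
          (𝟙 _ ◁ (G.map f ◁ (g b ◁ (α.naturality f').inv ▷ g c ⊗≫ (g b ≫ F.map f') ◁ (e c).inv)) ≫
            (k a).inv ▷ (G.map f ≫ ((g b ≫ F.map f') ≫ 𝟙 _))) ⊗≫
          g a ◁ (α.naturality f).inv ▷ (g b ≫ F.map f') ⊗≫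
            (g a ≫ F.map f) ◁ (e b).inv ▷ F.map f' ⊗≫ 𝟙 _ := by
      bicategory
    _ = 𝟙 _ ⊗≫ (𝟙 _ ◁ ((G.mapComp f f').hom ▷ g c ⊗≫ G.map f ◁ (k b).inv ▷ (G.map f' ≫ g c)) ≫
            (k a).inv ▷ _) ⊗≫
          g a ◁ ((α.app a ≫ G.map f) ◁ (g b ◁ (α.naturality f').inv ▷ g c ⊗≫
            (g b ≫ F.map f') ◁ (e c).inv) ≫
          (α.naturality f).inv ▷ ((g b ≫ F.map f') ≫ 𝟙 _)) ⊗≫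
            (g a ≫ F.map f) ◁ (e b).inv ▷ F.map f' ⊗≫ 𝟙 _ := by
      rw [whisker_exchange]; bicategory
    _ = 𝟙 _ ⊗≫ (k a).inv ▷ (G.map (f ≫ f') ≫ g c) ⊗≫
          g a ◁ α.app a ◁ (G.mapComp f f').hom ▷ g c ⊗≫
          g a ◁ ((α.app a ≫ G.map f) ◁ (k b).inv ≫ (α.naturality f).inv ▷ (g b ≫ α.app b)) ▷
            (G.map f' ≫ g c) ⊗≫
          (g a ≫ F.map f) ◁ (α.app b ◁ g b ◁ (α.naturality f').inv ▷ g c ⊗≫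
            ((α.app b ≫ g b) ◁ (F.map f' ◁ (e c).inv) ≫
              (e b).inv ▷ (F.map f' ≫ 𝟙 _))) ⊗≫ 𝟙 _ := by
      rw [whisker_exchange, whisker_exchange]; bicategory
    _ = 𝟙 _ ⊗≫ (k a).inv ▷ (G.map (f ≫ f') ≫ g c) ⊗≫
          g a ◁ α.app a ◁ (G.mapComp f f').hom ▷ g c ⊗≫
          g a ◁ (α.naturality f).inv ▷ (G.map f' ≫ g c) ⊗≫
          (g a ≫ F.map f) ◁ (α.app b ◁ (k b).inv ▷ (G.map f' ≫ g c) ⊗≫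
            ((α.app b ≫ g b) ◁ ((α.naturality f').inv ▷ g c) ≫
              (e b).inv ▷ _) ⊗≫ F.map f' ◁ (e c).inv) ⊗≫ 𝟙 _ := by
      rw [whisker_exchange, whisker_exchange]; bicategory
    _ = 𝟙 _ ⊗≫ (k a).inv ▷ (G.map (f ≫ f') ≫ g c) ⊗≫
          g a ◁ α.app a ◁ (G.mapComp f f').hom ▷ g c ⊗≫
          g a ◁ (α.naturality f).inv ▷ (G.map f' ≫ g c) ⊗≫
          (g a ≫ F.map f) ◁ ((α.app b ◁ (k b).inv ⊗≫ (e b).inv ▷ α.app b) ▷ (G.map f' ≫ g c) ⊗≫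
            (α.naturality f').inv ▷ g c ⊗≫ F.map f' ◁ (e c).inv) ⊗≫ 𝟙 _ := by
      rw [whisker_exchange]; bicategory
    -- The zigzag at `b` is removed. The cancelling pair of `F.mapComp` is inserted because the
    -- expanded square of `α` at `f ≫ f'` contains its inverse half.
    _ = 𝟙 _ ⊗≫ (k a).inv ▷ (G.map (f ≫ f') ≫ g c) ⊗≫
          g a ◁ α.app a ◁ (G.mapComp f f').hom ▷ g c ⊗≫
          g a ◁ (α.naturality f).inv ▷ (G.map f' ≫ g c) ⊗≫
          (g a ≫ F.map f) ◁ ((α.naturality f').inv ▷ g c ⊗≫ F.map f' ◁ (e c).inv) ⊗≫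
          g a ◁ ((F.mapComp f f').inv ≫ (F.mapComp f f').hom) ⊗≫ 𝟙 _ := by
      rw [zigzag_inv' _ _ (tri b), Iso.inv_hom_id]; bicategory
    _ = 𝟙 _ ⊗≫ (k a).inv ▷ (G.map (f ≫ f') ≫ g c) ⊗≫
          g a ◁ α.app a ◁ (G.mapComp f f').hom ▷ g c ⊗≫
          g a ◁ (α.naturality f).inv ▷ (G.map f' ≫ g c) ⊗≫
          (g a ≫ F.map f) ◁ ((α.naturality f').inv ▷ g c) ⊗≫
          g a ◁ ((F.map f ≫ F.map f') ◁ (e c).inv ≫ (F.mapComp f f').inv ▷ 𝟙 _) ⊗≫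
            g a ◁ (F.mapComp f f').hom ⊗≫ 𝟙 _ := by
      bicategory
    _ = _ := by
      rw [whisker_exchange]; bicategory

/-- The pseudonatural transformation formed by pointwise adjoint inverses. -/
def invTrans
    (tri : ∀ b, leftZigzag (e b).hom (k b).hom = (λ_ (α.app b)).hom ≫ (ρ_ (α.app b)).inv) : G ⟶ F where
  app := g
  naturality f := invSq α g e k f
  naturality_naturality θ := invSq_naturality α g e k θ
  naturality_id a := invSq_id α g e k tri a
  naturality_comp f f' := invSq_comp α g e k tri f f'

/-- The pointwise adjoint inverse is a right inverse up to an invertible modification. -/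
def compInvTransIso
    (tri : ∀ b, leftZigzag (e b).hom (k b).hom = (λ_ (α.app b)).hom ≫ (ρ_ (α.app b)).inv) : 𝟙 F ≅ α ≫ invTrans α g e k tri :=
  Pseudofunctor.StrongTrans.isoMk e (by
    intro a b f
    have h : F.map f ◁ (e b).hom ≫ (α_ _ _ _).inv ≫ (α.naturality f).hom ▷ g b ≫ (α_ _ _ _).hom ≫
        α.app a ◁ (invSq α g e k f).hom ≫ (α_ _ _ _).inv =
      ((ρ_ (F.map f)).hom ≫ (λ_ (F.map f)).inv) ≫ (e a).hom ▷ F.map f := by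
      rw [invSq_hom]
      -- The zigzag trades `(k a).inv` for `(e a).hom`, which slides past the square of `α`; that
      -- square then meets its inverse and cancels.
      have t : α.app a ◁ (k a).inv =
          𝟙 _ ⊗≫ (e a).hom ▷ α.app a ⊗≫ 𝟙 (α.app a ≫ g a ≫ α.app a) := by
        have h := zigzag_inv' _ _ (tri a) =≫ ((e a).hom ▷ α.app a ≫ (α_ _ _ _).hom)
        simpa [bicategoricalComp] using h
      calc
        _ = 𝟙 _ ⊗≫ F.map f ◁ (e b).hom ⊗≫ (α.naturality f).hom ▷ g b ⊗≫
              (α.app a ◁ (k a).inv) ▷ (G.map f ≫ g b) ⊗≫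
              (α.app a ≫ g a) ◁ (α.naturality f).inv ▷ g b ⊗≫
              (α.app a ≫ g a ≫ F.map f) ◁ (e b).inv ⊗≫ 𝟙 _ := by
          bicategory
        _ = 𝟙 _ ⊗≫ F.map f ◁ (e b).hom ⊗≫
              (𝟙 _ ◁ (α.naturality f).hom ▷ g b ≫ (e a).hom ▷ ((α.app a ≫ G.map f) ≫ g b)) ⊗≫
              (α.app a ≫ g a) ◁ (α.naturality f).inv ▷ g b ⊗≫
              (α.app a ≫ g a ≫ F.map f) ◁ (e b).inv ⊗≫ 𝟙 _ := by
          rw [t]; bicategory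
        _ = 𝟙 _ ⊗≫ (𝟙 _ ◁ F.map f ◁ (e b).hom ≫ (e a).hom ▷ (F.map f ≫ α.app b ≫ g b)) ⊗≫
              (α.app a ≫ g a) ◁ ((α.naturality f).hom ≫ (α.naturality f).inv) ▷ g b ⊗≫
              (α.app a ≫ g a ≫ F.map f) ◁ (e b).inv ⊗≫ 𝟙 _ := by
          rw [whisker_exchange]; bicategory
        _ = 𝟙 _ ⊗≫ (e a).hom ▷ F.map f ⊗≫
              (α.app a ≫ g a ≫ F.map f) ◁ ((e b).hom ≫ (e b).inv) ⊗≫ 𝟙 _ := by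
          rw [whisker_exchange, Iso.hom_inv_id]; bicategory
        _ = _ := by
          rw [Iso.hom_inv_id]; bicategory
    exact h)

end PointwiseInverse

/-! ### Equivalences, pseudoalgebras and retractions of the unit. -/

section Equivalences

variable {B : Type u₁} [Bicategory.{w₁, v₁} B] {C : Type u₂} [Bicategory.{w₂, v₂} C]

/-- A 1-cell is an equivalence if it has an inverse up to invertible 2-cells. -/
def IsEquiv {a b : B} (f : a ⟶ b) : Prop :=
  ∃ g : b ⟶ a, Nonempty (𝟙 a ≅ f ≫ g) ∧ Nonempty (g ≫ f ≅ 𝟙 b)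

/-- A transformation whose components are equivalences has a right inverse. -/
theorem exists_rightInverse {F G : B ⥤ᵖ C} (α : F ⟶ G) (h : ∀ b, IsEquiv (α.app b)) :
    ∃ β : G ⟶ F, Nonempty (𝟙 F ≅ α ≫ β) := by
  choose g e k using h
  let e' := fun b => (e b).some
  -- The counit is corrected to make each component an adjoint equivalence; arbitrary inverses need
  -- not give pseudonatural mates.
  let k' := fun b => adjointifyCounit (e' b) (k b).some
  have tri : ∀ b, leftZigzag (e' b).hom (k' b).hom = (λ_ (α.app b)).hom ≫ (ρ_ (α.app b)).inv :=
    fun b => congrArg Iso.hom (adjointifyCounit_left_triangle (e' b) (k b).some)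
  exact ⟨invTrans α g e' k' tri, ⟨compInvTransIso α g e' k' tri⟩⟩

/-- Every equivalence becomes an adjoint equivalence after changing its counit, so the triangle
identity is no further constraint. -/
theorem Pseudomonad.admitsPseudoalgebra_iff (M : Pseudomonad B) (X : B) :
    M.AdmitsPseudoalgebra X ↔ IsEquiv (monadUnitApp M.unit X) := by
  constructor
  · rintro ⟨s⟩
    exact ⟨s.act, ⟨s.adjCounit.symm⟩, ⟨s.adjUnit.symm⟩⟩
  · rintro ⟨g, ⟨e⟩, ⟨k⟩⟩
    exact ⟨⟨g, k.symm, adjointifyCounit k.symm e.symm,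
      adjointifyCounit_left_triangle k.symm e.symm⟩⟩

/-- The image under a pseudofunctor of a retraction. -/
def mapRetract (F : B ⥤ᵖ C) {a b : B} {f : a ⟶ b} {g : b ⟶ a} (e : 𝟙 a ≅ f ≫ g) :
    𝟙 (F.obj a) ≅ F.map f ≫ F.map g :=
  (F.mapId a).symm ≪≫ F.map₂Iso e ≪≫ F.mapComp f g

/-- The components of `η A : A ⟶ T A` for a transformation `η : Id ⟶ T`. -/
def unitWhisker (A : B ⥤ᵖ C) {T : C ⥤ᵖ C} (η : Pseudofunctor.id C ⟶ T) : A ⟶ A.comp T where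
  app b := monadUnitApp η (A.obj b)
  naturality f := monadUnitSq η (A.map f)
  naturality_naturality θ := η.naturality_naturality (A.map₂ θ)
  naturality_id a := by
    -- `preWhisker A η` starts at `A.comp (Pseudofunctor.id C)`, whose structure cells carry an
    -- extra identity; it is removed so that the source is `A` itself.
    have h := (preWhisker A η).naturality_id a
    have h' : (monadUnitSq η (A.map (𝟙 a))).hom ≫ monadUnitApp η (A.obj a) ◁
        ((A.comp T).mapId a).hom =
      ((A.mapId a).hom ≫ 𝟙 _) ▷ monadUnitApp η (A.obj a) ≫ (λ_ _).hom ≫ (ρ_ _).inv := h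
    rwa [Category.comp_id] at h'
  naturality_comp f g := by
    have h := (preWhisker A η).naturality_comp f g
    have h' : (monadUnitSq η (A.map (f ≫ g))).hom ≫ monadUnitApp η (A.obj _) ◁
        ((A.comp T).mapComp f g).hom =
      ((A.mapComp f g).hom ≫ 𝟙 _) ▷ monadUnitApp η (A.obj _) ≫ (α_ _ _ _).hom ≫
        A.map f ◁ (monadUnitSq η (A.map g)).hom ≫ (α_ _ _ _).inv ≫
          (monadUnitSq η (A.map f)).hom ▷ (A.comp T).map g ≫ (α_ _ _ _).hom := h
    rwa [Category.comp_id] at h'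

/-- If `η T ≅ T η` objectwise, an object whose unit has a retraction has an invertible unit. -/
theorem isEquiv_monadUnitApp_of_retract {T : C ⥤ᵖ C} (η : Pseudofunctor.id C ⟶ T)
    (X : C) (i : monadUnitApp η (T.obj X) ≅ T.map (monadUnitApp η X))
    {r : T.obj X ⟶ X} (e : 𝟙 X ≅ monadUnitApp η X ≫ r) : IsEquiv (monadUnitApp η X) :=
  -- The chain `r ≫ η_X ≅ η_{TX} ≫ T r ≅ T η_X ≫ T r ≅ 𝟙`.
  ⟨r, ⟨e⟩, ⟨monadUnitSq η r ≪≫ whiskerRightIso i (T.map r) ≪≫ (mapRetract T e).symm⟩⟩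

end Equivalences

/-! ### Transport of invertibility along effective descent. -/

section Descent

variable {B : Type u₁} [Bicategory.{w₁, v₁} B] {C : Type u₂} [Bicategory.{w₂, v₂} C]
  {D : Type u₃} [Bicategory.{w₃, v₃} D]

/-- If `A` is a retract of `U (L A)` via the unit, and `L φ` has a right inverse, then so
has `φ : A ⟶ A'`. -/
theorem Biadjunction.exists_rightInverse {L : B ⥤ᵖ C} {U : C ⥤ᵖ B} (adj : Biadjunction L U)
    {A A' : B} (φ : A ⟶ A') {r : U.obj (L.obj A) ⟶ A} (e : 𝟙 A ≅ unitApp adj.unit A ≫ r)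
    {ψ : L.obj A' ⟶ L.obj A} (k : 𝟙 (L.obj A) ≅ L.map φ ≫ ψ) :
    ∃ ρ : A' ⟶ A, Nonempty (𝟙 A ≅ φ ≫ ρ) :=
  -- By pseudonaturality of the unit, `φ` followed by this 1-cell is the unit at `A` followed by `U
  -- (L φ ≫ ψ)` and `r`, hence the identity. No triangle of the biadjunction is involved.
  ⟨unitApp adj.unit A' ≫ U.map ψ ≫ r, ⟨e ≪≫ whiskerLeftIso _ ((λ_ r).symm ≪≫
    whiskerRightIso (mapRetract U k) r ≪≫ α_ _ _ _) ≪≫ (α_ _ _ _).symm ≪≫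
      whiskerRightIso (unitSq adj.unit φ).symm (U.map ψ ≫ r) ≪≫ α_ _ _ _⟩⟩

/-- Effective descent transports invertibility of the unit of an idempotent `T` from the image
of `t` to every object. -/
theorem GlobalPseudoKan.isEquiv_monadUnitApp {t : B ⥤ᵖ C} (R : GlobalPseudoKan t D)
    {T : D ⥤ᵖ D} (η : Pseudofunctor.id D ⟶ T)
    (hη : ∀ X, Nonempty (monadUnitApp η (T.obj X) ≅ T.map (monadUnitApp η X)))
    (A : C ⥤ᵖ D) (hA : R.IsEffectiveDescent A)
    (ht : ∀ i, IsEquiv (monadUnitApp η (A.obj (t.obj i)))) (a : C) :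
    IsEquiv (monadUnitApp η (A.obj a)) := by
  -- Only the retraction half of the equivalence `A ≃ Ran (A ∘ t)` is kept.
  obtain ⟨r, ⟨e⟩, -⟩ := (Pseudomonad.admitsPseudoalgebra_iff _ _).1 hA
  obtain ⟨ψ, ⟨k⟩⟩ := PsDescent.exists_rightInverse
    ((precomp t D).map (unitWhisker A η)) ht
  obtain ⟨ρ, ⟨m⟩⟩ := R.adj.exists_rightInverse (unitWhisker A η) e k
  -- Component at `a` of the invertible modification `m`.
  have m' : 𝟙 (A.obj a) ≅ monadUnitApp η (A.obj a) ≫ ρ.app a :=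
    { hom := m.hom.as.app a
      inv := m.inv.as.app a
      hom_inv_id := congrArg (fun Γ => Γ.as.app a) m.hom_inv_id
      inv_hom_id := congrArg (fun Γ => Γ.as.app a) m.inv_hom_id }
  exact isEquiv_monadUnitApp_of_retract η (A.obj a) (hη _).some m'

end Descent

/-! ### The bicategorical Yoneda lemma, phrased with universal elements. -/

section Yoneda

variable {B : Type u₁} [Bicategory.{w₁, v₁} B]

/-- The functor `f ↦ S f u` determined by an element `u` of a `Cat`-valued pseudofunctor. -/
def evalAt (S : B ⥤ᵖ Cat.{w₂, v₂}) {i : B} (u : S.obj i) (j : B) : (i ⟶ j) ⥤ S.obj j where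
  obj f := (S.map f).toFunctor.obj u
  map θ := (S.map₂ θ).toNatTrans.app u

/-- An element `u` of `S i` is universal if all the functors `f ↦ S f u` are equivalences. -/
def IsUniversalElement (S : B ⥤ᵖ Cat.{w₂, v₂}) {i : B} (u : S.obj i) : Prop :=
  ∀ j, (evalAt S u j).IsEquivalence

/-- Compatibility of `evalAt` with composition of 1-cells. -/
def evalComp (S : B ⥤ᵖ Cat.{w₂, v₂}) {i j k : B} (u : S.obj i) (f : i ⟶ j) (h : j ⟶ k) :
    (evalAt S u k).obj (f ≫ h) ≅ (S.map h).toFunctor.obj ((evalAt S u j).obj f) :=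
  (Cat.Hom.toNatIso (S.mapComp f h)).app u

section

variable (S : B ⥤ᵖ Cat.{w₂, v₂}) {i j k l : B} (u : S.obj i)

/-- This and the next three identities say that evaluation at `u` is pseudonatural from `i ⟶ -` to
`S`, with `evalComp` as its squares. -/
theorem evalComp_whiskerRight {f f' : i ⟶ j} (θ : f ⟶ f') (h : j ⟶ k) :
    (evalAt S u k).map (θ ▷ h) ≫ (evalComp S u f' h).hom =
      (evalComp S u f h).hom ≫ (S.map h).toFunctor.map ((evalAt S u j).map θ) := by
  simp [evalAt, evalComp]

theorem evalComp_whiskerLeft (f : i ⟶ j) {h h' : j ⟶ k} (θ : h ⟶ h') :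
    (evalAt S u k).map (f ◁ θ) ≫ (evalComp S u f h').hom =
      (evalComp S u f h).hom ≫ (S.map₂ θ).toNatTrans.app ((evalAt S u j).obj f) := by
  simp [evalAt, evalComp]

theorem evalComp_id (f : i ⟶ j) :
    (evalComp S u f (𝟙 j)).hom ≫ (S.mapId j).hom.toNatTrans.app ((evalAt S u j).obj f) =
      (evalAt S u j).map (ρ_ f).hom := by
  simp [evalAt, evalComp]

theorem evalComp_comp (f : i ⟶ j) (h : j ⟶ k) (h' : k ⟶ l) :
    (evalComp S u f (h ≫ h')).hom ≫ (S.mapComp h h').hom.toNatTrans.app ((evalAt S u j).obj f) =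
      (evalAt S u l).map (α_ f h h').inv ≫ (evalComp S u (f ≫ h) h').hom ≫
        (S.map h').toFunctor.map (evalComp S u f h).hom := by
  rw [← cancel_epi ((evalAt S u l).map (α_ f h h').hom), ← Functor.map_comp_assoc]
  simp [evalAt, evalComp]

-- Every object of `S.obj j` is isomorphic to some `S f u`, so naturality fixes the remaining
-- components.
variable {S u} in
theorem IsUniversalElement.natTrans_ext (hu : IsUniversalElement S u) {X : Type*} [Category X]
    {P Q : S.obj j ⥤ X} {σ τ : P ⟶ Q}
    (h : ∀ f, σ.app ((evalAt S u j).obj f) = τ.app ((evalAt S u j).obj f)) : σ = τ := by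
  have := hu j
  ext s
  let e := (evalAt S u j).objObjPreimageIso s
  rw [← cancel_epi (P.map e.hom), σ.naturality, τ.naturality, h]

/-- Extension of a natural isomorphism along the equivalence given by a universal element. -/
theorem IsUniversalElement.exists_natIso {S : B ⥤ᵖ Cat.{w₂, v₂}} {i j : B} {u : S.obj i}
    (hu : IsUniversalElement S u) {X : Type*} [Category X]
    {P Q : S.obj j ⥤ X} (γ : evalAt S u j ⋙ P ≅ evalAt S u j ⋙ Q) :
    ∃ Γ : P ≅ Q, ∀ f, Γ.hom.app ((evalAt S u j).obj f) = γ.hom.app f := by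
  have := hu j
  -- Precomposition with an equivalence is fully faithful, so `γ` lifts.
  refine ⟨((Functor.whiskeringLeft _ _ X).obj (evalAt S u j)).preimageIso γ, fun f => ?_⟩
  exact congrArg (fun z => NatTrans.app z f)
    (((Functor.whiskeringLeft _ _ X).obj (evalAt S u j)).map_preimage γ.hom)

end

section Uniqueness

variable {S F : B ⥤ᵖ Cat.{w₂, v₂}} {i : B} {u : S.obj i} (β β' : S ⟶ F)
  (m : (β.app i).toFunctor.obj u ≅ (β'.app i).toFunctor.obj u)

theorem natSq_naturality {a b : B} {f g : a ⟶ b} (θ : f ⟶ g) (s : S.obj a) :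
    (β.app b).toFunctor.map ((S.map₂ θ).toNatTrans.app s) ≫
        (β.naturality g).hom.toNatTrans.app s =
      (β.naturality f).hom.toNatTrans.app s ≫
        (F.map₂ θ).toNatTrans.app ((β.app a).toFunctor.obj s) :=
  congrArg (fun Γ => Γ.toNatTrans.app s) (β.naturality_naturality θ)

/-- The isomorphism `β (S f u) ≅ β' (S f u)` determined by `β u ≅ β' u`. -/
def evalIso {j : B} (f : i ⟶ j) : (β.app j).toFunctor.obj ((evalAt S u j).obj f) ≅
    (β'.app j).toFunctor.obj ((evalAt S u j).obj f) :=
  (Cat.Hom.toNatIso (β.naturality f)).app u ≪≫ (F.map f).toFunctor.mapIso m ≪≫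
    ((Cat.Hom.toNatIso (β'.naturality f)).app u).symm

theorem evalIso_naturality {j : B} {f f' : i ⟶ j} (θ : f ⟶ f') :
    (β.app j).toFunctor.map ((evalAt S u j).map θ) ≫ (evalIso β β' m f').hom =
      (evalIso β β' m f).hom ≫ (β'.app j).toFunctor.map ((evalAt S u j).map θ) := by
  have h := natSq_naturality β θ u
  have h' := natSq_naturality β' θ u
  rw [← Cat.Hom.toNatIso_hom, ← Cat.Hom.toNatIso_hom] at h h'
  have e : (β.app j).toFunctor.map ((S.map₂ θ).toNatTrans.app u) ≫
      (Cat.Hom.toNatIso (β.naturality f')).hom.app u ≫ (F.map f').toFunctor.map m.hom ≫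
        (Cat.Hom.toNatIso (β'.naturality f')).inv.app u =
    ((Cat.Hom.toNatIso (β.naturality f)).hom.app u ≫ (F.map f).toFunctor.map m.hom ≫
        (Cat.Hom.toNatIso (β'.naturality f)).inv.app u) ≫
          (β'.app j).toFunctor.map ((S.map₂ θ).toNatTrans.app u) := by
    rw [← cancel_mono ((Cat.Hom.toNatIso (β'.naturality f')).hom.app u)]
    simp only [Category.assoc, Iso.inv_hom_id_app, h']
    rw [← Category.assoc, h]
    simp
  exact e

/-- This is the modification axiom tested at `S f u`: the composition axioms of `β` and `β'` reduce
both sides to `m` transported along `F f` and then `F h`. -/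
theorem evalIso_comp {j k : B} (f : i ⟶ j) (h : j ⟶ k) :
    (β.app k).toFunctor.map (evalComp S u f h).hom ≫
      (β.naturality h).hom.toNatTrans.app ((evalAt S u j).obj f) ≫
        (F.map h).toFunctor.map (evalIso β β' m f).hom =
    (evalIso β β' m (f ≫ h)).hom ≫ (β'.app k).toFunctor.map (evalComp S u f h).hom ≫
      (β'.naturality h).hom.toNatTrans.app ((evalAt S u j).obj f) := by
  have h₁ := β.naturality_comp_hom_app f h u
  have h₂ := β'.naturality_comp_hom_app f h u
  have h₃ : (β'.app k).toFunctor.map ((S.mapComp f h).hom.toNatTrans.app u) ≫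
      (β'.naturality h).hom.toNatTrans.app ((S.map f).toFunctor.obj u) =
    (β'.naturality (f ≫ h)).hom.toNatTrans.app u ≫
      (F.mapComp f h).hom.toNatTrans.app ((β'.app i).toFunctor.obj u) ≫
        (F.map h).toFunctor.map ((β'.naturality f).inv.toNatTrans.app u) := by
    simp [h₂, ← Functor.map_comp]
  simp [evalIso, evalComp, evalAt, h₁, h₃]

/-- Transformations out of a pseudofunctor with a universal element are determined up to
isomorphism by their values at the universal element. -/
theorem IsUniversalElement.nonempty_iso (hu : IsUniversalElement S u)
    (m : (β.app i).toFunctor.obj u ≅ (β'.app i).toFunctor.obj u) : Nonempty (β ≅ β') := by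
  have key : ∀ j, ∃ Γ : (β.app j).toFunctor ≅ (β'.app j).toFunctor,
      ∀ f, Γ.hom.app ((evalAt S u j).obj f) = (evalIso β β' m f).hom := fun j =>
    hu.exists_natIso (NatIso.ofComponents (fun f => evalIso β β' m f)
      (fun θ => evalIso_naturality β β' m θ))
  choose Γ hΓ using key
  refine ⟨Pseudofunctor.StrongTrans.isoMk (fun j => Cat.Hom.isoMk (Γ j)) ?_⟩
  intro j k h
  ext1
  refine hu.natTrans_ext fun f => ?_
  have e : (Γ k).hom.app ((S.map h).toFunctor.obj ((evalAt S u j).obj f)) ≫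
      (β'.naturality h).hom.toNatTrans.app ((evalAt S u j).obj f) =
    (β.naturality h).hom.toNatTrans.app ((evalAt S u j).obj f) ≫
      (F.map h).toFunctor.map ((Γ j).hom.app ((evalAt S u j).obj f)) := by
    rw [← cancel_epi ((β.app k).toFunctor.map (evalComp S u f h).hom), hΓ, evalIso_comp, ← hΓ,
      NatTrans.naturality_assoc]
  exact e

end Uniqueness

section Existence

variable {S F : B ⥤ᵖ Cat.{w₂, v₂}} {i : B} {u : S.obj i} (x : F.obj i)

/-- There is a transformation out of a pseudofunctor with a universal element taking any
prescribed value at the universal element. -/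
theorem IsUniversalElement.exists_trans (hu : IsUniversalElement S u) :
    ∃ β : S ⟶ F, Nonempty ((β.app i).toFunctor.obj u ≅ x) := by
  -- The transformation must send `S f u` to `F f x`, which dictates the functor `(evalAt S u j)⁻¹ ⋙
  -- evalAt F x j`.
  have key : ∀ j, ∃ β₀ : S.obj j ⥤ F.obj j, Nonempty (evalAt S u j ⋙ β₀ ≅ evalAt F x j) := by
    intro j
    have := hu j
    exact ⟨(evalAt S u j).inv ⋙ evalAt F x j, ⟨(Functor.associator _ _ _).symm ≪≫
      Functor.isoWhiskerRight (evalAt S u j).asEquivalence.unitIso.symm _ ≪≫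
        Functor.leftUnitor _⟩⟩
  choose β₀ c using key
  replace c := fun j => (c j).some
  -- The squares are likewise forced on the objects `S f u`: there they must match `evalComp` for
  -- `S` with `evalComp` for `F`. The recorded equation is all that the axioms below use of them.
  have key₂ : ∀ {j k : B} (h : j ⟶ k),
      ∃ Γ : (S.map h).toFunctor ⋙ β₀ k ≅ β₀ j ⋙ (F.map h).toFunctor,
        ∀ f, (β₀ k).map (evalComp S u f h).hom ≫ Γ.hom.app ((evalAt S u j).obj f) ≫
            (F.map h).toFunctor.map ((c j).hom.app f) =
          (c k).hom.app (f ≫ h) ≫ (evalComp F x f h).hom := by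
    intro j k h
    obtain ⟨Γ, hΓ⟩ := hu.exists_natIso (P := (S.map h).toFunctor ⋙ β₀ k)
      (Q := β₀ j ⋙ (F.map h).toFunctor) (NatIso.ofComponents (fun f =>
        (β₀ k).mapIso (evalComp S u f h).symm ≪≫ (c k).app (f ≫ h) ≪≫ evalComp F x f h ≪≫
          (F.map h).toFunctor.mapIso ((c j).app f).symm) (by
            intro f f' θ
            have h₁ := (c k).hom.naturality (θ ▷ h)
            have h₂ := (F.map h).toFunctor.congr_map ((c j).inv.naturality θ)
            have h₃ := (β₀ k).congr_map (evalComp_whiskerRight S u θ h)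
            have h₄ := evalComp_whiskerRight F x θ h
            simp only [Functor.comp_map, Functor.map_comp] at h₁ h₂ h₃
            rw [← cancel_epi ((β₀ k).map (evalComp S u f h).hom)]
            simp only [Functor.comp_map, Iso.trans_hom, Functor.mapIso_hom, Iso.symm_hom,
              Iso.app_hom, Iso.app_inv, Category.assoc]
            rw [← reassoc_of% h₃, Iso.map_hom_inv_id_assoc, Iso.map_hom_inv_id_assoc,
              reassoc_of% h₁, reassoc_of% h₄, ← h₂]))
    refine ⟨Γ, fun f => ?_⟩
    rw [hΓ]
    simp only [NatIso.ofComponents_hom_app, Iso.trans_hom, Functor.mapIso_hom, Iso.symm_hom,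
      Iso.app_hom, Iso.app_inv, Category.assoc]
    rw [Iso.map_hom_inv_id_assoc, ← Functor.map_comp, Iso.inv_hom_id_app]
    simp [evalAt]
  choose n hn using fun (j k : B) (h : j ⟶ k) => key₂ h
  refine ⟨{ app := fun j => (β₀ j).toCatHom
            naturality := fun h => Cat.Hom.isoMk (n _ _ h)
            naturality_naturality := ?_
            naturality_id := ?_
            naturality_comp := ?_ }, ⟨(β₀ i).mapIso ?_ ≪≫ (c i).app (𝟙 i) ≪≫ ?_⟩⟩
  -- Each axiom is tested at `S f u` and composed with invertible `evalComp` and `c` cells; it then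
  -- becomes the matching identity of `evalComp` for `F` and `x`.
  · intro j k h h' θ
    ext1
    refine hu.natTrans_ext fun f => ?_
    have e : (β₀ k).map ((S.map₂ θ).toNatTrans.app ((evalAt S u j).obj f)) ≫
        (n j k h').hom.app ((evalAt S u j).obj f) = (n j k h).hom.app ((evalAt S u j).obj f) ≫
          (F.map₂ θ).toNatTrans.app ((β₀ j).obj ((evalAt S u j).obj f)) := by
      have h₁ := (F.map₂ θ).toNatTrans.naturality ((c j).hom.app f)
      have h₂ := (c k).hom.naturality (f ◁ θ)
      have h₃ := (β₀ k).congr_map (evalComp_whiskerLeft S u f θ)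
      have h₄ := evalComp_whiskerLeft F x f θ
      simp only [Functor.comp_map, Functor.map_comp] at h₂ h₃
      rw [← cancel_epi ((β₀ k).map (evalComp S u f h).hom),
        ← cancel_mono ((F.map h').toFunctor.map ((c j).hom.app f))]
      simp only [Category.assoc]
      erw [← h₁]
      rw [← reassoc_of% h₃, hn, reassoc_of% h₂, h₄, reassoc_of% (hn j k h f)]
    exact e
  · intro j
    ext1
    refine hu.natTrans_ext fun f => ?_
    have e : (n j j (𝟙 j)).hom.app ((evalAt S u j).obj f) ≫
        (F.mapId j).hom.toNatTrans.app ((β₀ j).obj ((evalAt S u j).obj f)) =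
      (β₀ j).map ((S.mapId j).hom.toNatTrans.app ((evalAt S u j).obj f)) := by
      have h₁ := (F.mapId j).hom.toNatTrans.naturality ((c j).hom.app f)
      have h₂ := (c j).hom.naturality (ρ_ f).hom
      have h₃ := (β₀ j).congr_map (evalComp_id S u f)
      have h₄ := evalComp_id F x f
      simp only [Functor.comp_map, Functor.map_comp] at h₂ h₃
      rw [← cancel_epi ((β₀ j).map (evalComp S u f (𝟙 j)).hom), ← cancel_mono ((c j).hom.app f)]
      simp only [Category.assoc]
      erw [← h₁]
      rw [reassoc_of% (hn j j (𝟙 j) f), h₄, ← h₂, reassoc_of% h₃]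
    exact e.trans ((Category.comp_id _).symm.trans
      (congrArg (fun z => (β₀ j).map ((S.mapId j).hom.toNatTrans.app ((evalAt S u j).obj f)) ≫ z)
        (Category.comp_id (𝟙 _)).symm))
  · intro j k l h h'
    ext1
    refine hu.natTrans_ext fun f => ?_
    have e : (n j l (h ≫ h')).hom.app ((evalAt S u j).obj f) ≫
        (F.mapComp h h').hom.toNatTrans.app ((β₀ j).obj ((evalAt S u j).obj f)) =
      (β₀ l).map ((S.mapComp h h').hom.toNatTrans.app ((evalAt S u j).obj f)) ≫
        (n k l h').hom.app ((S.map h).toFunctor.obj ((evalAt S u j).obj f)) ≫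
          (F.map h').toFunctor.map ((n j k h).hom.app ((evalAt S u j).obj f)) := by
      have h₁ := (F.mapComp h h').hom.toNatTrans.naturality ((c j).hom.app f)
      have h₂ := (c l).hom.naturality (α_ f h h').inv
      have h₃ := (β₀ l).congr_map (evalComp_comp S u f h h')
      have h₄ := evalComp_comp F x f h h'
      have h₅ := (n k l h').hom.naturality (evalComp S u f h).hom
      have h₆ := (F.map h').toFunctor.congr_map (hn j k h f)
      simp only [Functor.comp_map, Functor.map_comp] at h₂ h₃ h₅ h₆
      rw [← cancel_epi ((β₀ l).map (evalComp S u f (h ≫ h')).hom),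
        ← cancel_mono ((F.map h').toFunctor.map ((F.map h).toFunctor.map ((c j).hom.app f)))]
      simp only [Category.assoc]
      erw [← h₁]
      rw [reassoc_of% (hn j l (h ≫ h') f), h₄, ← reassoc_of% h₂, reassoc_of% h₃,
        reassoc_of% h₅, h₆, reassoc_of% (hn k l h' (f ≫ h))]
    -- The inserted identities are the components of the associators of `Cat`.
    have e' : (β₀ l).map ((S.mapComp h h').hom.toNatTrans.app ((evalAt S u j).obj f)) ≫
        (n k l h').hom.app ((S.map h).toFunctor.obj ((evalAt S u j).obj f)) ≫
          (F.map h').toFunctor.map ((n j k h).hom.app ((evalAt S u j).obj f)) =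
      (β₀ l).map ((S.mapComp h h').hom.toNatTrans.app ((evalAt S u j).obj f)) ≫ 𝟙 _ ≫
        (n k l h').hom.app ((S.map h).toFunctor.obj ((evalAt S u j).obj f)) ≫ 𝟙 _ ≫
          (F.map h').toFunctor.map ((n j k h).hom.app ((evalAt S u j).obj f)) ≫ 𝟙 _ := by
      simp
    exact e.trans e'
  -- The value at `u` is computed as `u ≅ S 𝟙 u`, sent by `c` to `F 𝟙 x ≅ x`.
  · exact ((Cat.Hom.toNatIso (S.mapId i)).app u).symm
  · exact (Cat.Hom.toNatIso (F.mapId i)).app x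

end Existence

end Yoneda

/-! ### Universal elements of representables and of their restrictions. -/

section Representable

variable {B : Type u₁} [Bicategory.{w₁, v₁} B] {C : Type u₂} [Bicategory.{w₂, v₂} C]

/-- The identity is a universal element of a representable, also after restriction along a local
equivalence. -/
theorem isUniversalElement_comp_representable (t : B ⥤ᵖ C)
    (ht : ∀ i j, (t.mapFunctor i j).IsEquivalence) (i : B) :
    IsUniversalElement (t.comp (representable (t.obj i))) (i := i) (𝟙 (t.obj i)) := by
  intro j
  have := ht i j
  -- Evaluation at the identity is `f ↦ 𝟙 ≫ t f`, the hom functor of `t` up to a left unitor.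
  exact Functor.isEquivalence_of_iso (F := t.mapFunctor i j)
    (NatIso.ofComponents (fun f => (λ_ (t.map f)).symm)
      (fun θ => leftUnitor_inv_naturality (t.map₂ θ)))

theorem isUniversalElement_representable (c : C) :
    IsUniversalElement (representable c) (i := c) (𝟙 c) := by
  intro j
  exact Functor.isEquivalence_of_iso (F := 𝟭 (c ⟶ j))
    (NatIso.ofComponents (fun f => (λ_ f).symm) (fun θ => leftUnitor_inv_naturality θ))

/-- The Yoneda argument is invariant under equivalence, so the isomorphism on hom-categories is
weakened to the form consumed there. -/
theorem IsOneObjectInclusion.isEquivalence_mapFunctor {t : StrictPseudofunctor B C} {x : C}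
    (ht : IsOneObjectInclusion t x) (i j : B) :
    (t.toPseudofunctor.mapFunctor i j).IsEquivalence where
  faithful := ⟨fun {f g} _ _ h => (ht.map₂_bijective f g).1 h⟩
  full := ⟨fun {f g} θ => (ht.map₂_bijective f g).2 θ⟩
  essSurj := ⟨fun g => by
    obtain ⟨f, rfl⟩ := (ht.map_bijective i j).2 g
    exact ⟨f, ⟨Iso.refl _⟩⟩⟩

/-- Evaluation of an isomorphism of transformations between `Cat`-valued pseudofunctors. -/
def evalTransIso {S F : B ⥤ᵖ Cat.{w₂, v₂}} {β β' : S ⟶ F} (m : β ≅ β') {i : B} (s : S.obj i) :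
    (β.app i).toFunctor.obj s ≅ (β'.app i).toFunctor.obj s where
  hom := (m.hom.as.app i).toNatTrans.app s
  inv := (m.inv.as.app i).toNatTrans.app s
  hom_inv_id := congrArg (fun Γ => (Γ.as.app i).toNatTrans.app s) m.hom_inv_id
  inv_hom_id := congrArg (fun Γ => (Γ.as.app i).toNatTrans.app s) m.inv_hom_id

end Representable

/-! ### `Cat`-valued pseudo-Kan extensions on isomorphism classes of objects. -/

section Kan

variable {B : Type u₁} [Bicategory.{w₁, v₁} B] {C : Type u₂} [Bicategory.{w₂, v₂} C]
  {t : B ⥤ᵖ C} {F : B ⥤ᵖ Cat.{w₂, v₂}} {R : C ⥤ᵖ Cat.{w₂, v₂}} {κ : t.comp R ⟶ F}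

/-- For a `Cat`-valued pseudo-Kan extension along a local equivalence, the components of the
universal transformation are essentially surjective. -/
theorem IsRightPseudoKan.exists_obj (hκ : IsRightPseudoKan t F R κ)
    (ht : ∀ i j, (t.mapFunctor i j).IsEquivalence) {i : B} (x : F.obj i) :
    ∃ r : R.obj (t.obj i), Nonempty ((kanApp κ i).toFunctor.obj r ≅ x) := by
  -- By Yoneda `x` is a transformation `β` from the restricted representable; its lift `α` through
  -- the Kan property, evaluated at the identity, is the required `r`.
  obtain ⟨β, ⟨e⟩⟩ := (isUniversalElement_comp_representable t ht i).exists_trans (F := F) x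
  have := hκ (representable (t.obj i))
  let α := ((precomp t Cat).mapFunctor (representable (t.obj i)) R ⋙
    (postcomposing (t.comp (representable (t.obj i))) (t.comp R) F).obj κ).objPreimage β
  let m := ((precomp t Cat).mapFunctor (representable (t.obj i)) R ⋙
    (postcomposing (t.comp (representable (t.obj i))) (t.comp R) F).obj κ).objObjPreimageIso β
  exact ⟨(α.app (t.obj i)).toFunctor.obj (𝟙 (t.obj i)),
    ⟨evalTransIso m (i := i) (𝟙 (t.obj i)) ≪≫ e⟩⟩

/-- For a `Cat`-valued pseudo-Kan extension along a local equivalence, the components of the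
universal transformation are injective on isomorphism classes. -/
theorem IsRightPseudoKan.nonempty_iso (hκ : IsRightPseudoKan t F R κ)
    (ht : ∀ i j, (t.mapFunctor i j).IsEquivalence) {i : B} {r r' : R.obj (t.obj i)}
    (e : (kanApp κ i).toFunctor.obj r ≅ (kanApp κ i).toFunctor.obj r') : Nonempty (r ≅ r') := by
  have hS := isUniversalElement_representable (t.obj i)
  obtain ⟨α, ⟨a⟩⟩ := hS.exists_trans (F := R) r
  obtain ⟨α', ⟨a'⟩⟩ := hS.exists_trans (F := R) r'
  have := hκ (representable (t.obj i))
  -- The restrictions of `α` and `α'`, composed with `κ`, agree up to isomorphism at the universal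
  -- element, hence are isomorphic; full faithfulness in the Kan property lifts this to `α ≅ α'`.
  obtain ⟨m⟩ := (isUniversalElement_comp_representable t ht i).nonempty_iso
    (((precomp t Cat).mapFunctor (representable (t.obj i)) R ⋙
      (postcomposing (t.comp (representable (t.obj i))) (t.comp R) F).obj κ).obj α)
    (((precomp t Cat).mapFunctor (representable (t.obj i)) R ⋙
      (postcomposing (t.comp (representable (t.obj i))) (t.comp R) F).obj κ).obj α')
    ((kanApp κ i).toFunctor.mapIso a ≪≫ e ≪≫ (kanApp κ i).toFunctor.mapIso a'.symm)
  exact ⟨a.symm ≪≫ evalTransIso (((precomp t Cat).mapFunctor (representable (t.obj i)) R ⋙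
    (postcomposing (t.comp (representable (t.obj i))) (t.comp R) F).obj κ).preimageIso m)
      (𝟙 (t.obj i)) ≪≫ a'⟩

end Kan

/-! ### Invertibility of the counit of a pointwise extension. -/

section Pointwise

variable {B : Type u₁} [Bicategory.{w₁, v₁} B] {C : Type u₂} [Bicategory.{w₃, v₃} C]
  {D : Type u₃} [Bicategory.{w₃, v₃} D] {t : B ⥤ᵖ C}

/-- The counit of a pointwise pseudo-Kan extension along a local equivalence consists of
equivalences. -/
theorem GlobalPseudoKan.IsPointwise.isEquiv_kanApp {K : GlobalPseudoKan t D} (hK : K.IsPointwise)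
    (ht : ∀ i j, (t.mapFunctor i j).IsEquivalence) (A : B ⥤ᵖ D) (i : B) :
    IsEquiv (kanApp (counitApp K.adj.counit A) i) := by
  -- Testing at `Z = A i` lifts the identity to a section `s` of the counit component.
  obtain ⟨s, ⟨e⟩⟩ := (hK A (A.obj i)).exists_obj ht (i := i) (𝟙 (A.obj i))
  have e : s ≫ kanApp (counitApp K.adj.counit A) i ≅ 𝟙 (A.obj i) := e
  let k := kanApp (counitApp K.adj.counit A) i
  have e' : 𝟙 _ ≫ k ≅ (k ≫ s) ≫ k :=
    λ_ k ≪≫ (ρ_ k).symm ≪≫ whiskerLeftIso k e.symm ≪≫ (α_ k s k).symm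
  -- Testing at `Z = (Ran A)(t i)`: `𝟙` and `k ≫ s` become isomorphic after composition with `k`, so
  -- they are isomorphic already.
  obtain ⟨m⟩ := (hK A ((K.ran.obj A).obj (t.obj i))).nonempty_iso ht (i := i)
    (r := 𝟙 _) (r' := k ≫ s) e'
  exact ⟨s, ⟨m⟩, ⟨e⟩⟩

end Pointwise

/-! ### Idempotency from a right inverse of the counit. -/

section Idempotent

variable {B : Type u₁} [Bicategory.{w₁, v₁} B] {C : Type u₂} [Bicategory.{w₂, v₂} C]
  {L : B ⥤ᵖ C} {U : C ⥤ᵖ B}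

/-- If the counit has a right inverse, then `η T ≅ T η` objectwise for the induced
pseudomonad. -/
theorem Biadjunction.nonempty_unit_iso (adj : Biadjunction L U) (X : B)
    {s : L.obj X ⟶ L.obj (U.obj (L.obj X))} (e : 𝟙 _ ≅ counitApp adj.counit (L.obj X) ≫ s) :
    Nonempty (monadUnitApp adj.pseudomonad.unit (adj.pseudomonad.T.obj X) ≅
      adj.pseudomonad.T.map (monadUnitApp adj.pseudomonad.unit X)) := by
  let q := multApp adj.pseudomonad.mult X
  let e' : 𝟙 _ ≅ q ≫ U.map s := mapRetract U e
  -- Any section `p` of `q` satisfies `p ≅ p ≫ q ≫ U s ≅ U s`. By the unit laws both `η T` and `T η`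
  -- are sections of the multiplication.
  have h : ∀ p : adj.pseudomonad.T.obj X ⟶ adj.pseudomonad.T.obj (adj.pseudomonad.T.obj X),
      Nonempty (p ≫ q ≅ 𝟙 _) → Nonempty (p ≅ U.map s) := fun p ⟨i⟩ =>
    ⟨(ρ_ p).symm ≪≫ whiskerLeftIso p e' ≪≫ (α_ p q _).symm ≪≫ whiskerRightIso i (U.map s) ≪≫
      λ_ (U.map s)⟩
  obtain ⟨i⟩ := h _ ⟨adj.pseudomonad.leftUnit X⟩
  obtain ⟨j⟩ := h _ ⟨(adj.pseudomonad.rightUnit X).symm⟩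
  exact ⟨i ≪≫ j.symm⟩

end Idempotent

end PsDescent

theorem mainTheorem6
    {𝔸 : Type u₁} [Bicategory.{w₁, v₁} 𝔸] [Bicategory.Strict 𝔸]
    {𝔸' : Type u₂} [Bicategory.{w₂, v₂} 𝔸'] [Bicategory.Strict 𝔸']
    (t : StrictPseudofunctor 𝔸 𝔸') (a : 𝔸') (_ht : PsDescent.IsOneObjectInclusion t a) :
    (∀ (K : Type u₃) [Bicategory.{w₃, v₃} K] [Bicategory.Strict K]
      (R : PsDescent.GlobalPseudoKan t.toPseudofunctor K)
      (T : PsDescent.Pseudomonad K), T.IsIdempotent →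
      ∀ A : 𝔸' ⥤ᵖ K, R.IsEffectiveDescent A →
        (∀ i : 𝔸, T.AdmitsPseudoalgebra (A.obj (t.obj i))) →
        T.AdmitsPseudoalgebra (A.obj a)) ∧
    (∀ (𝔹 : Type u₄) [Bicategory.{w₄, v₄} 𝔹] [Bicategory.Strict 𝔹]
      (𝔹' : Type u₅) [Bicategory.{w₅, v₅} 𝔹'] [Bicategory.Strict 𝔹']
      (H : Type u₆) [Bicategory.{w₅, v₅} H] [Bicategory.Strict H]
      (h : StrictPseudofunctor 𝔹 𝔹') (b : 𝔹'), PsDescent.IsOneObjectInclusion h b →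
      ∀ (Rh : PsDescent.GlobalPseudoKan h.toPseudofunctor H), Rh.IsPointwise →
      ∀ (Rt : PsDescent.GlobalPseudoKan t.toPseudofunctor (𝔹' ⥤ᵖ H))
        (A : 𝔸' ⥤ᵖ (𝔹' ⥤ᵖ H)), Rt.IsEffectiveDescent A →
        (∀ i : 𝔸, Rh.IsEffectiveDescent (A.obj (t.obj i))) →
        Rh.IsEffectiveDescent (A.obj a)) := by
  constructor
  · intro K _ _ R T hT A hA hi
    obtain ⟨hT⟩ := hT
    rw [PsDescent.Pseudomonad.admitsPseudoalgebra_iff]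
    exact R.isEquiv_monadUnitApp T.unit (fun X => ⟨hT.iso X⟩) A hA
      (fun i => (PsDescent.Pseudomonad.admitsPseudoalgebra_iff _ _).1 (hi i)) a
  · intro 𝔹 _ _ 𝔹' _ _ H _ _ h b hb Rh hRh Rt A hA hi
    refine (PsDescent.Pseudomonad.admitsPseudoalgebra_iff _ _).2
      (Rt.isEquiv_monadUnitApp Rh.pseudomonad.unit (fun X => ?_) A hA
        (fun i => (PsDescent.Pseudomonad.admitsPseudoalgebra_iff _ _).1 (hi i)) a)
    -- The counit is needed only at restrictions `X ∘ h`; its components there are equivalences, so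
    -- it has a pseudonatural right inverse.
    obtain ⟨s, ⟨e⟩⟩ := PsDescent.exists_rightInverse
      (PsDescent.counitApp Rh.adj.counit ((PsDescent.precomp h.toPseudofunctor H).obj X))
      (fun i => hRh.isEquiv_kanApp hb.isEquivalence_mapFunctor _ i)
    exact Rh.adj.nonempty_unit_iso X e
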